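/- Let $n\ge 2$, let $\mathbf d=(d_1,\dots,d_n)$ be positive integers and let $\boldsymbol\gamma=(\gamma_1,\dots,\gamma_n)\in\mathbb C^n$ with $\Re\gamma_j>0$ for all $j$. Let $\zeta_{n,\mathbf d,\boldsymbol\gamma}(\mathbf s)$ denote the meromorphic continuation to $\mathbf s\in\mathbb C^n$ of the multiple series $$\sum_{m_1,\dots,m_n\ge 1}\ \prod_{j=1}^n\bigl(\gamma_1m_1^{d_1}+\cdots+\gamma_jm_j^{d_j}\bigr)^{-s_j},$$ which converges absolutely for $\Re(s_j+\cdots+s_n)>\frac1{d_j}+\cdots+\frac1{d_n}$ $(1\le j\le n)$ (powers are taken with the principal branch). Assume that $$\frac1{d_j}+\sum_{k=j+1}^n\frac{\varepsilon_k}{d_k}\notin\{1,2,3,\dots\}\qquad\text{for all } 1\le j\le n \text{ and all } \varepsilon_{j+1},\dots,\varepsilon_n\in\{0,1\}.$$ Put $\mathbf d'=(d_1,\dots,d_{n-1})$ and $\boldsymbol\gamma'=(\gamma_1,\dots,\gamma_{n-1})$, and let $B_m$ be the Bernoulli numbers, $\frac{X}{e^X-1}=\sum_{m\ge0}\frac{B_m}{m!}X^m$.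 Then for every $\mathbf N=(N_1,\dots,N_n)\in\mathbb Z^n$ with $N_n\le 0$, the continuations involved exist, all points at which values are taken below are regular points, and $$\zeta_{n,\mathbf d,\boldsymbol\gamma}(\mathbf N)=-\frac12\,\zeta_{n-1,\mathbf d',\boldsymbol\gamma'}\bigl(N_1,\dots,N_{n-2},N_{n-1}+N_n\bigr)$$ $$-\sum_{\substack{1\le k\le\lfloor(1-d_nN_n)/2\rfloor\\ d_n\mid 2k-1}}\frac{B_{2k}}{2k}\binom{-N_n}{(2k-1)/d_n}\gamma_n^{(2k-1)/d_n}\,\zeta_{n-1,\mathbf d',\boldsymbol\gamma'}\Bigl(N_1,\dots,N_{n-2},N_{n-1}+N_n+\frac{2k-1}{d_n}\Bigr).$$ -/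

import Mathlib

open Filter Topology

namespace PowerZeta

/-- The linear form in powers `γ₁ m₁^{d₁} + ⋯ + γⱼ mⱼ^{dⱼ}`. -/
noncomputable def partialForm {n : ℕ} (d : Fin n → ℕ) (γ : Fin n → ℂ) (m : Fin n → ℕ+)
    (j : Fin n) : ℂ :=
  ∑ i ∈ Finset.Iic j, γ i * ((m i : ℕ) : ℂ) ^ d i

/-- The general term `1 / ∏ⱼ (γ₁ m₁^{d₁} + ⋯ + γⱼ mⱼ^{dⱼ})^{sⱼ}` of the multiple series (principal
branch of the power; for `Re γᵢ > 0` all bases lie in the right half plane). -/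
noncomputable def zetaTerm {n : ℕ} (d : Fin n → ℕ) (γ : Fin n → ℂ) (s : Fin n → ℂ)
    (m : Fin n → ℕ+) : ℂ :=
  1 / ∏ j, partialForm d γ m j ^ s j

/-- The domain of absolute convergence
`Re (sⱼ + ⋯ + sₙ) > 1/dⱼ + ⋯ + 1/dₙ` for all `1 ≤ j ≤ n`. -/
def convDomain {n : ℕ} (d : Fin n → ℕ) : Set (Fin n → ℂ) :=
  {s | ∀ j, ∑ i ∈ Finset.Ici j, 1 / (d i : ℝ) < (∑ i ∈ Finset.Ici j, s i).re}

/-- `F` represents a meromorphic function on `ℂⁿ`: near every point it is a quotient `g / h` of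
holomorphic functions, `h` not identically zero near that point. The values of `F` on the zero sets
of the local denominators are irrelevant. -/
def IsMeromorphic {n : ℕ} (F : (Fin n → ℂ) → ℂ) : Prop :=
  ∀ a, ∃ g h : (Fin n → ℂ) → ℂ, AnalyticAt ℂ g a ∧ AnalyticAt ℂ h a ∧ ¬ (∀ᶠ z in 𝓝 a, h z = 0) ∧
    ∀ᶠ z in 𝓝 a, h z ≠ 0 → F z = g z / h z

/-- The meromorphic function represented by `F` is regular (holomorphic) at `a`, with value `v`
there: off a proper analytic subset `{h = 0}`, `F` coincides near `a` with a function `φ` holomorphic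
at `a`, and `φ a = v`. -/
def HasRegularValue {n : ℕ} (F : (Fin n → ℂ) → ℂ) (a : Fin n → ℂ) (v : ℂ) : Prop :=
  ∃ φ h : (Fin n → ℂ) → ℂ, AnalyticAt ℂ φ a ∧ AnalyticAt ℂ h a ∧ ¬ (∀ᶠ z in 𝓝 a, h z = 0) ∧
    (∀ᶠ z in 𝓝 a, h z ≠ 0 → F z = φ z) ∧ φ a = v

/-- `F` is a meromorphic continuation to `ℂⁿ` of the (absolutely convergent) multiple series. -/
def IsContinuation {n : ℕ} (d : Fin n → ℕ) (γ : Fin n → ℂ) (F : (Fin n → ℂ) → ℂ) : Prop :=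
  IsMeromorphic F ∧ ∀ s ∈ convDomain d, HasSum (zetaTerm d γ s) (F s)

/-- `v` is the value at the regular point `s` of the meromorphically continued multiple zeta
function. -/
def IsZetaValue {n : ℕ} (d : Fin n → ℕ) (γ : Fin n → ℂ) (s : Fin n → ℂ) (v : ℂ) : Prop :=
  ∃ F, IsContinuation d γ F ∧ HasRegularValue F s v

/-- The meromorphic continuation of the multiple zeta function exists, and `s` is a regular point
of it. -/
def IsRegularPoint {n : ℕ} (d : Fin n → ℕ) (γ : Fin n → ℂ) (s : Fin n → ℂ) : Prop :=
  ∃ v, IsZetaValue d γ s v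

/-- Helper: a holomorphic germ vanishing off the zero set of a nonzero holomorphic germ is zero. -/
theorem eventually_zero_of_off_zeros {n : ℕ} {φ h : (Fin n → ℂ) → ℂ} {a : Fin n → ℂ}
    (hφ : AnalyticAt ℂ φ a) (hh : AnalyticAt ℂ h a) (h0 : ¬ ∀ᶠ z in 𝓝 a, h z = 0)
    (H : ∀ᶠ z in 𝓝 a, h z ≠ 0 → φ z = 0) : ∀ᶠ z in 𝓝 a, φ z = 0 := by
  obtain ⟨r, hr, hB⟩ := Metric.eventually_nhds_iff_ball.1
    ((hφ.eventually_analyticAt.and hh.eventually_analyticAt).and H)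
  have hex : ∃ z ∈ Metric.ball a r, h z ≠ 0 := by
    by_contra hcon
    push Not at hcon
    exact h0 (Filter.eventually_of_mem (Metric.ball_mem_nhds a hr) hcon)
  obtain ⟨z, hz, hzne⟩ := hex
  have hlocal : φ =ᶠ[𝓝 z] 0 := by
    filter_upwards [(hB z hz).1.2.continuousAt.eventually_ne hzne,
      Metric.isOpen_ball.mem_nhds hz] with w hw hwB
    exact (hB w hwB).2 hw
  have hφB : AnalyticOnNhd ℂ φ (Metric.ball a r) := fun w hw => (hB w hw).1.1
  have := hφB.eqOn_zero_of_preconnected_of_eventuallyEq_zero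
    (convex_ball a r).isPreconnected hz hlocal
  exact Filter.eventually_of_mem (Metric.ball_mem_nhds a hr) this

/-- Helper: a product of nonzero holomorphic germs is nonzero. -/
theorem mul_germ_ne_zero {n : ℕ} {h k : (Fin n → ℂ) → ℂ} {a : Fin n → ℂ}
    (hh : AnalyticAt ℂ h a) (hk : AnalyticAt ℂ k a) (h0 : ¬ ∀ᶠ z in 𝓝 a, h z = 0)
    (k0 : ¬ ∀ᶠ z in 𝓝 a, k z = 0) : ¬ ∀ᶠ z in 𝓝 a, h z * k z = 0 := fun H =>
  k0 (eventually_zero_of_off_zeros hk hh h0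
    (H.mono fun _ hz hne => (mul_eq_zero.1 hz).resolve_left hne))

/-- Helper: nonzero germs stay nonzero at nearby points. -/
theorem eventually_germ_ne_zero {n : ℕ} {h : (Fin n → ℂ) → ℂ} {a : Fin n → ℂ}
    (hh : AnalyticAt ℂ h a) (h0 : ¬ ∀ᶠ z in 𝓝 a, h z = 0) :
    ∀ᶠ w in 𝓝 a, ¬ ∀ᶠ z in 𝓝 w, h z = 0 := by
  obtain ⟨r, hr, hB⟩ := Metric.eventually_nhds_iff_ball.1 hh.eventually_analyticAt
  refine Filter.eventually_of_mem (Metric.ball_mem_nhds a hr) fun w hw hz => h0 ?_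
  exact Filter.eventually_of_mem (Metric.ball_mem_nhds a hr)
    (AnalyticOnNhd.eqOn_zero_of_preconnected_of_eventuallyEq_zero hB
      (convex_ball a r).isPreconnected hw hz)

/-- `F` and `G` represent the same meromorphic germ at `a`. -/
def SameGerm {n : ℕ} (F G : (Fin n → ℂ) → ℂ) (a : Fin n → ℂ) : Prop :=
  ∃ h : (Fin n → ℂ) → ℂ, AnalyticAt ℂ h a ∧ ¬ (∀ᶠ z in 𝓝 a, h z = 0) ∧
    ∀ᶠ z in 𝓝 a, h z ≠ 0 → F z = G z

/-- Helper: the regular value depends only on the meromorphic germ. -/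
theorem SameGerm.value_unique {n : ℕ} {F G : (Fin n → ℂ) → ℂ} {a : Fin n → ℂ}
    (hFG : SameGerm F G a) {v w : ℂ} (hv : HasRegularValue F a v) (hw : HasRegularValue G a w) :
    v = w := by
  obtain ⟨k, hk, k0, hk'⟩ := hFG
  obtain ⟨φ, h, hφ, hh, h0, hF, rfl⟩ := hv
  obtain ⟨ψ, l, hψ, hl, l0, hG, rfl⟩ := hw
  have := eventually_zero_of_off_zeros (hφ.sub hψ) (hk.mul (hh.mul hl))
    (mul_germ_ne_zero hk (hh.mul hl) k0 (mul_germ_ne_zero hh hl h0 l0)) (by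
      filter_upwards [hk', hF, hG] with z h1 h2 h3 hne
      simp only [Pi.mul_apply, ne_eq, mul_eq_zero, not_or] at hne
      simp only [Pi.sub_apply]
      rw [← h2 hne.2.1, ← h3 hne.2.2, h1 hne.1, sub_self])
  exact sub_eq_zero.1 this.self_of_nhds

/-- Helper: meromorphic functions on `ℂⁿ` with the same germ at one point have the same germ at every
point. -/
theorem sameGerm_everywhere {n : ℕ} {F G : (Fin n → ℂ) → ℂ} (hF : IsMeromorphic F)
    (hG : IsMeromorphic G) {a : Fin n → ℂ} (ha : SameGerm F G a) (b : Fin n → ℂ) :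
    SameGerm F G b := by
  have hclopen : IsClopen {a | SameGerm F G a} := by
    constructor
    · refine isClosed_of_closure_subset fun c hc => ?_
      obtain ⟨g, h, hg, hh, h0, e⟩ := hF c
      obtain ⟨g', h', hg', hh', h0', e'⟩ := hG c
      have hden : AnalyticAt ℂ (h * h') c := hh.mul hh'
      have hden0 := mul_germ_ne_zero hh hh' h0 h0'
      have hnum : AnalyticAt ℂ (g * h' - g' * h) c := (hg.mul hh').sub (hg'.mul hh)
      obtain ⟨r, hr, hB⟩ := Metric.eventually_nhds_iff_ball.1
        (((hnum.eventually_analyticAt.and hden.eventually_analyticAt).and (e.and e')).and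
          (eventually_germ_ne_zero hden hden0))
      obtain ⟨w, hw, hwc⟩ := Metric.mem_closure_iff.1 hc r hr
      have hwB : w ∈ Metric.ball c r := by rwa [Metric.mem_ball, dist_comm]
      obtain ⟨k, hk, k0, hk'⟩ := hw
      have hz : ∀ᶠ z in 𝓝 w, (g * h' - g' * h) z = 0 :=
        eventually_zero_of_off_zeros (hB w hwB).1.1.1 (hk.mul (hB w hwB).1.1.2)
          (mul_germ_ne_zero hk (hB w hwB).1.1.2 k0 (hB w hwB).2) (by
            filter_upwards [hk', Metric.isOpen_ball.mem_nhds hwB] with z h1 hzB hne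
            simp only [Pi.mul_apply, ne_eq, mul_eq_zero, not_or] at hne
            have e1 := (hB z hzB).1.2.1 hne.2.1
            have e2 := (hB z hzB).1.2.2 hne.2.2
            have e3 := h1 hne.1
            rw [e1, e2, div_eq_div_iff hne.2.1 hne.2.2] at e3
            simp [e3])
      have hall : Set.EqOn (g * h' - g' * h) 0 (Metric.ball c r) :=
        AnalyticOnNhd.eqOn_zero_of_preconnected_of_eventuallyEq_zero
          (fun z hz => (hB z hz).1.1.1) (convex_ball c r).isPreconnected hwB hz
      refine ⟨h * h', hden, hden0, ?_⟩
      filter_upwards [Metric.ball_mem_nhds c hr] with z hzB hne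
      simp only [Pi.mul_apply, ne_eq, mul_eq_zero, not_or] at hne
      rw [(hB z hzB).1.2.1 hne.1, (hB z hzB).1.2.2 hne.2, div_eq_div_iff hne.1 hne.2]
      exact sub_eq_zero.1 (hall hzB)
    · rw [isOpen_iff_mem_nhds]
      rintro c ⟨h, hh, h0, e⟩
      filter_upwards [hh.eventually_analyticAt, eventually_germ_ne_zero hh h0,
        e.eventually_nhds] with w h1 h2 h3
      exact ⟨h, h1, h2, h3⟩
  have := hclopen.eq_univ ⟨a, ha⟩
  exact (Set.ext_iff.1 this b).2 (Set.mem_univ b)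

/-- Helper: the value at a regular point is unique. -/
theorem IsZetaValue.unique {n : ℕ} {d : Fin n → ℕ} {γ s : Fin n → ℂ} {v w : ℂ}
    (hv : IsZetaValue d γ s v) (hw : IsZetaValue d γ s w) : v = w := by
  obtain ⟨F, ⟨hF, hFs⟩, hFv⟩ := hv
  obtain ⟨G, ⟨hG, hGs⟩, hGw⟩ := hw
  have hopen : IsOpen (convDomain d) := by
    simp only [convDomain, Set.ofPred_forall]
    exact isOpen_iInter_of_finite fun j => isOpen_lt continuous_const (by fun_prop)
  let p : Fin n → ℂ := fun i => ((1 / (d i : ℝ) + 1 : ℝ) : ℂ)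
  have hp : p ∈ convDomain d := by
    intro j
    rw [Complex.re_sum]
    refine Finset.sum_lt_sum_of_nonempty ⟨j, Finset.mem_Ici.2 le_rfl⟩ fun i _ => ?_
    simp only [p, Complex.ofReal_re]
    linarith
  have hgerm : SameGerm F G p := by
    refine ⟨1, analyticAt_const, fun H => one_ne_zero H.self_of_nhds, ?_⟩
    filter_upwards [hopen.mem_nhds hp] with z hz _
    exact (hFs z hz).unique (hGs z hz)
  exact (sameGerm_everywhere hF hG hgerm s).value_unique hFv hGw

open Classical in
/-- The value `ζ_{n,d,γ}(s)` of the meromorphically continued multiple zeta function at a regular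
point `s` (and `0` at all other points). -/
noncomputable def zeta {n : ℕ} (d : Fin n → ℕ) (γ : Fin n → ℂ) (s : Fin n → ℂ) : ℂ :=
  if h : IsRegularPoint d γ s then h.choose else 0

/-- Helper: `zeta` takes the value of the continuation. -/
theorem IsZetaValue.zeta_eq {n : ℕ} {d : Fin n → ℕ} {γ s : Fin n → ℂ} {v : ℂ}
    (hv : IsZetaValue d γ s v) : zeta d γ s = v := by
  have h : IsRegularPoint d γ s := ⟨v, hv⟩
  rw [zeta, dif_pos h]
  exact h.choose_spec.unique hv

/-- The non-integrality assumption: `1/dⱼ + ∑_{k > j} εₖ/dₖ` is not a positive integer, for all `j`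
and all `εₖ ∈ {0, 1}`. -/
def NonIntegral {n : ℕ} (d : Fin n → ℕ) : Prop :=
  ∀ (j : Fin n) (ε : Fin n → ℕ), (∀ k, ε k = 0 ∨ ε k = 1) →
    ∀ M : ℕ, 0 < M → 1 / (d j : ℚ) + ∑ k ∈ Finset.Ioi j, (ε k : ℚ) / (d k : ℚ) ≠ (M : ℚ)

/-- `(N₁, …, Nₙ) ↦ (N₁, …, N_{n-2}, N_{n-1} + Nₙ + l)`. -/
def mergeLast {n : ℕ} (N : Fin (n + 2) → ℤ) (l : ℤ) : Fin (n + 1) → ℤ :=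
  Fin.snoc (fun i : Fin n => N i.castSucc.castSucc)
    (N (Fin.last n).castSucc + N (Fin.last (n + 1)) + l)

/-- An integer point, viewed in `ℂⁿ`. -/
def intPoint {n : ℕ} (N : Fin n → ℤ) : Fin n → ℂ := fun j => (N j : ℂ)

/-- The indices `1 ≤ k ≤ [(1 - e M) / 2]` with `e ∣ 2k - 1`. -/
def recIndices (e : ℕ) (M : ℤ) : Finset ℕ :=
  {k ∈ Finset.Icc 1 ((1 - (e : ℤ) * M) / 2).toNat | e ∣ 2 * k - 1}

end PowerZeta

/-!
Write the last variable of the series as `s`, and put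
`A = γ₁ m₁^{d₁} + ⋯ + γ_{n-1} m_{n-1}^{d_{n-1}}`.
The sum over the last index is a Mellin transform,
`∑_m (A + γ m^d)^{-s} = Γ(s)⁻¹ ∫₀^∞ t^{s-1} e^{-At} θ(t) dt`, with `θ(t) = ∑_m exp(-γ m^d t)`.
The Euler–Maclaurin formula gives `θ(t) = c t^{-1/d} + ∑_{i<K} c_i t^i + O(t^K)`, with the error
bound valid for all `t > 0` (`norm_thetaRem_le`), and integrating term by term (`hasSum_inner`) one
finds, `Z` being the multiple zeta function of depth `n - 1` and `Z(s + a)` its value at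
`(s₁, …, s_{n-2}, s_{n-1} + s + a)`, that the series of depth `n` equals
`c Γ(s)⁻¹ Γ(s - 1/d) Z(s - 1/d) + ∑_{i<K} c_i s(s+1)⋯(s+i-1) Z(s + i) + Γ(s)⁻¹ R_K`.

The remainder `R_K` is a series over the first `n - 1` indices. The integrals in it are bounded by
`Γ(Re s + K) (Re A)^{-Re s - K}`, so it converges locally uniformly on a region that exhausts `ℂⁿ`
as `K → ∞` (`exists_remTerm_bound`). Its sum is holomorphic there by Weierstrass' theorem in several
variables (`analyticAt_tsum`), which is deduced from Osgood's lemma (`analyticAt_of_separately`).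
The right hand sides for different `K` agree wherever both are defined, so by induction on the depth
they define the meromorphic continuation (`cont`, `exists_continuation`). The same induction,
starting from `γ^{-s} ζ(ds)` in depth one, shows that the continuation is holomorphic off the
hyperplanes `sⱼ + ⋯ + sₙ + l = 1/dⱼ + ∑_{k>j} εₖ/dₖ` (`OffPoles`). Under the non-integrality
assumption no integer point lies on one of these (`NonIntegral.offPoles`).

At `s = -M` the factor `Γ(s)⁻¹` vanishes, and what is left is the finite sum over `i ≤ M`
(`cont_intPoint`). There `c_i` contains the Bernoulli number of index `di + 1`, which vanishes for
odd index greater than one, so only `i = 0` and the `i` with `di + 1 = 2k` contribute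
(`sum_range_eq_sum_recIndices`).
-/

namespace PowerZeta

/-! ### Holomorphic functions of several variables -/

section

open MeasureTheory Metric

/-- **Cauchy's formula** on a polydisc (a ball for the sup norm), for a continuous function that is
holomorphic in each variable separately. -/
theorem torusIntegral_cauchy {n : ℕ} {f : (Fin n → ℂ) → ℂ} {c : Fin n → ℂ} {r : ℝ} (hr : 0 < r)
    (hc : ContinuousOn f (closedBall c r))
    (hd : ∀ z ∈ closedBall c r, ∀ i, DifferentiableOn ℂ (fun w => f (Function.update z i w))
      (ball (c i) r)) {z : Fin n → ℂ} (hz : z ∈ ball c r) :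
    torusIntegral (fun w => (∏ i, (w i - z i)⁻¹) * f w) c (fun _ => r)
      = (2 * Real.pi * Complex.I) ^ n * f z := by
  induction n with
  | zero =>
    rw [torusIntegral_dim0]
    simp [Subsingleton.elim c z]
  | succ n ih =>
    have hmem : ∀ {θ : Fin (n + 1) → ℝ}, torusMap c (fun _ => r) θ ∈ closedBall c r := by
      intro θ
      rw [mem_closedBall, dist_pi_le_iff hr.le]
      intro i
      simp [torusMap, dist_eq_norm, Complex.norm_exp_ofReal_mul_I, abs_of_pos hr]
    have hne : ∀ {x a b : ℂ}, x ∈ sphere a r → b ∈ ball a r → x - b ≠ 0 := by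
      intro x a b hx hb h
      rw [sub_eq_zero] at h
      subst h
      rw [mem_sphere] at hx
      rw [mem_ball] at hb
      exact hb.ne hx
    have hzi : ∀ i, z i ∈ ball (c i) r := fun i => (dist_le_pi_dist z c i).trans_lt hz
    have hint : TorusIntegrable (fun w => (∏ i, (w i - z i)⁻¹) * f w) c (fun _ => r) := by
      refine ContinuousOn.integrableOn_compact isCompact_Icc (Continuous.continuousOn ?_)
      have htc : Continuous (torusMap c (fun _ => r)) := by unfold torusMap; fun_prop
      refine Continuous.mul (continuous_finsetProd _ fun i _ => Continuous.inv₀ (by fun_prop) ?_)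
        (hc.comp_continuous htc fun _ => hmem)
      intro θ
      refine hne (a := c i) ?_ (hzi i)
      simp [torusMap, Complex.norm_exp_ofReal_mul_I, abs_of_pos hr]
    rw [torusIntegral_succ hint]
    have hcons : ∀ {x : ℂ} {y : Fin n → ℂ}, x ∈ closedBall (c 0) r →
        y ∈ closedBall (c ∘ Fin.succ) r → (Fin.cons x y : Fin (n + 1) → ℂ) ∈ closedBall c r := by
      intro x y hx hy
      rw [mem_closedBall, dist_pi_le_iff hr.le] at *
      intro i
      refine Fin.cases ?_ (fun j => ?_) i
      · simpa using hx
      · simpa using hy j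
    have hinner : ∀ x ∈ sphere (c 0) r,
        torusIntegral (fun y => (∏ i, ((Fin.cons x y : Fin (n + 1) → ℂ) i - z i)⁻¹)
          * f (Fin.cons x y)) (c ∘ Fin.succ) (fun _ => r)
        = (2 * Real.pi * Complex.I) ^ n * ((x - z 0)⁻¹ • f (Fin.cons x (z ∘ Fin.succ))) := by
      intro x hx
      have hx' := sphere_subset_closedBall hx
      have := ih (f := fun y => f (Fin.cons x y)) (c := c ∘ Fin.succ) (z := z ∘ Fin.succ)
        (hc.comp (by fun_prop) fun y hy => hcons hx' hy) (fun y hy i => by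
          have := hd _ (hcons hx' hy) i.succ
          simpa [Fin.cons_update] using this)
        (by
          rw [mem_ball, dist_pi_lt_iff hr]
          exact fun i => hzi i.succ)
      rw [smul_eq_mul, mul_left_comm, ← this, ← torusIntegral_const_mul]
      congr 1
      ext y
      rw [Fin.prod_univ_succ]
      simp [mul_assoc]
    have hco : ((fun _ => r) ∘ Fin.succ : Fin n → ℝ) = fun _ => r := rfl
    rw [hco, circleIntegral.integral_congr hr.le (g := fun x => (2 * Real.pi * Complex.I) ^ n *
      ((x - z 0)⁻¹ • f (Fin.cons x (z ∘ Fin.succ)))) (fun x hx => hinner x hx),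
      circleIntegral.integral_const_mul]
    have hz' : (z ∘ Fin.succ) ∈ closedBall (c ∘ Fin.succ) r := by
      rw [mem_closedBall, dist_pi_le_iff hr.le]
      exact fun i => (hzi i.succ).le
    have hcl : DiffContOnCl ℂ (fun x => f (Fin.cons x (z ∘ Fin.succ))) (ball (c 0) r) := by
      constructor
      · have := hd _ (hcons (mem_closedBall_self hr.le) hz') 0
        simpa using this
      · rw [closure_ball _ hr.ne']
        exact hc.comp (by fun_prop) fun x hx => hcons hx hz'
    rw [hcl.circleIntegral_sub_inv_smul (hzi 0)]
    have : (Fin.cons (z 0) (z ∘ Fin.succ) : Fin (n + 1) → ℂ) = z := Fin.cons_self_tail z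
    rw [this, smul_eq_mul, pow_succ]
    ring

open BoundedContinuousFunction in
/-- **Osgood's lemma**: a continuous, separately holomorphic function is analytic. The kernel of
Cauchy's formula depends analytically on the point, as an element of the Banach algebra of bounded
continuous functions of the angles. -/
theorem analyticAt_of_separately {n : ℕ} {f : (Fin n → ℂ) → ℂ} {c : Fin n → ℂ} {r : ℝ} (hr : 0 < r)
    (hc : ContinuousOn f (closedBall c r))
    (hd : ∀ z ∈ closedBall c r, ∀ i, DifferentiableOn ℂ (fun w => f (Function.update z i w))
      (ball (c i) r)) : AnalyticAt ℂ f c := by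
  let T : (Fin n → ℝ) → (Fin n → ℂ) := torusMap c (fun _ => r)
  have htc : Continuous T := by unfold T torusMap; fun_prop
  have hmem : ∀ θ, T θ ∈ closedBall c r := by
    intro θ
    rw [mem_closedBall, dist_pi_le_iff hr.le]
    intro i
    simp [T, torusMap, dist_eq_norm, Complex.norm_exp_ofReal_mul_I, abs_of_pos hr]
  let W : Fin n → ((Fin n → ℝ) →ᵇ ℂ) := fun i =>
    BoundedContinuousFunction.ofNormedAddCommGroup (fun θ => T θ i) (by fun_prop) (‖c i‖ + r)
      (fun θ => by
        refine (norm_add_le _ _).trans ?_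
        simp [Complex.norm_exp_ofReal_mul_I, abs_of_pos hr])
  let V : Fin n → ((Fin n → ℝ) →ᵇ ℂ) := fun i =>
    BoundedContinuousFunction.ofNormedAddCommGroup (fun θ => (T θ i - c i)⁻¹) (by
        refine Continuous.inv₀ (by fun_prop) fun θ => ?_
        simp [T, torusMap, hr.ne']) r⁻¹
      (fun θ => by simp [T, torusMap, Complex.norm_exp_ofReal_mul_I, abs_of_pos hr])
  have hW : ∀ i θ z, (W i - algebraMap ℂ ((Fin n → ℝ) →ᵇ ℂ) z) θ = T θ i - z := by
    intro i θ z
    rw [BoundedContinuousFunction.sub_apply, BoundedContinuousFunction.algebraMap_apply,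
      smul_eq_mul, mul_one]
    rfl
  have hunit : ∀ i, IsUnit (W i - algebraMap ℂ _ (c i)) := by
    intro i
    refine IsUnit.of_mul_eq_one (V i) ?_
    ext θ
    have : T θ i - c i ≠ 0 := by simp [T, torusMap, hr.ne']
    rw [BoundedContinuousFunction.mul_apply, hW]
    exact mul_inv_cancel₀ this
  let K : (Fin n → ℂ) → ((Fin n → ℝ) →ᵇ ℂ) := fun z =>
    ∏ i, Ring.inverse (W i - algebraMap ℂ _ (z i))
  have hsub : ∀ i, AnalyticAt ℂ
      (fun z : Fin n → ℂ => W i - algebraMap ℂ ((Fin n → ℝ) →ᵇ ℂ) (z i)) c := by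
    intro i
    have h1 : AnalyticAt ℂ (fun z : Fin n → ℂ => z i) c :=
      (ContinuousLinearMap.proj (R := ℂ) (φ := fun _ : Fin n => ℂ) i).analyticAt c
    refine analyticAt_const.sub ?_
    simp only [Algebra.algebraMap_eq_smul_one]
    exact h1.smul analyticAt_const
  have hK : AnalyticAt ℂ K c := by
    refine Finset.analyticAt_fun_prod _ fun i _ => ?_
    exact (analyticAt_inverse (𝕜 := ℂ) (hunit i).unit).comp (f := fun z : Fin n → ℂ =>
      W i - algebraMap ℂ ((Fin n → ℝ) →ᵇ ℂ) (z i)) (hsub i)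
  let D : (Fin n → ℝ) → ℂ := fun θ => (∏ i, r * Complex.exp (θ i * Complex.I) * Complex.I)
  have hDc : Continuous D := by unfold D; fun_prop
  have hfT : Continuous fun θ => f (T θ) := hc.comp_continuous htc hmem
  let S : Set (Fin n → ℝ) := Set.Icc 0 fun _ => 2 * Real.pi
  have hI : ∀ g : (Fin n → ℝ) →ᵇ ℂ, IntegrableOn (fun θ => D θ * (g θ * f (T θ))) S :=
    fun g => (hDc.mul (g.continuous.mul hfT)).continuousOn.integrableOn_compact isCompact_Icc
  let Λ₀ : ((Fin n → ℝ) →ᵇ ℂ) →ₗ[ℂ] ℂ :=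
    { toFun := fun g => ∫ θ in S, D θ * (g θ * f (T θ))
      map_add' := fun g h => by
        rw [← integral_add (hI g) (hI h)]
        simp [add_mul, mul_add]
      map_smul' := fun a g => by
        rw [RingHom.id_apply, smul_eq_mul, ← integral_const_mul]
        congr 1; ext θ; simp; ring }
  let Λ : ((Fin n → ℝ) →ᵇ ℂ) →L[ℂ] ℂ := Λ₀.mkContinuous (∫ θ in S, ‖D θ * f (T θ)‖) (fun g => by
    have hB : IntegrableOn (fun θ => ‖D θ * f (T θ)‖) S :=
      (hDc.mul hfT).norm.continuousOn.integrableOn_compact isCompact_Icc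
    change ‖∫ θ in S, D θ * (g θ * f (T θ))‖ ≤ _
    refine (norm_integral_le_integral_norm _).trans ?_
    rw [← integral_mul_const]
    refine integral_mono (hI g).norm (hB.mul_const _) fun θ => ?_
    simp only [norm_mul]
    nlinarith [g.norm_coe_le_norm θ, mul_nonneg (norm_nonneg (D θ)) (norm_nonneg (f (T θ)))])
  have hΛ : AnalyticAt ℂ (fun z => ((2 * Real.pi * Complex.I) ^ n)⁻¹ * Λ (K z)) c :=
    analyticAt_const.mul ((Λ.analyticAt _).comp hK)
  refine hΛ.congr ?_
  -- near `c` the elements inverted stay units, so `Ring.inverse` is the pointwise inverse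
  have hev : ∀ᶠ z in 𝓝 c, ∀ i, IsUnit (W i - algebraMap ℂ ((Fin n → ℝ) →ᵇ ℂ) (z i)) := by
    rw [eventually_all]
    exact fun i => (hsub i).continuousAt.eventually_mem (Units.isOpen.mem_nhds (hunit i))
  filter_upwards [hev, ball_mem_nhds c hr] with z hz hzb
  have hKz : ∀ θ, K z θ = ∏ i, (T θ i - z i)⁻¹ := by
    intro θ
    have h2 : ∀ i, (Ring.inverse (W i - algebraMap ℂ ((Fin n → ℝ) →ᵇ ℂ) (z i))) θ
        = (T θ i - z i)⁻¹ := by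
      intro i
      have := congrArg (fun g : (Fin n → ℝ) →ᵇ ℂ => g θ) (Ring.mul_inverse_cancel _ (hz i))
      exact eq_inv_of_mul_eq_one_right (by
        simpa only [BoundedContinuousFunction.mul_apply, hW, BoundedContinuousFunction.coe_one,
          Pi.one_apply] using this)
    simp [K, h2]
  have : Λ (K z) = (2 * Real.pi * Complex.I) ^ n * f z := by
    rw [← torusIntegral_cauchy hr hc hd hzb]
    change ∫ θ in S, D θ * (K z θ * f (T θ)) = _
    simp only [hKz]
    rfl
  rw [this, inv_mul_cancel_left₀]
  exact pow_ne_zero _ Complex.two_pi_I_ne_zero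

/-- **Weierstrass' theorem** in several variables, for normally convergent series. -/
theorem analyticAt_tsum {n : ℕ} {ι : Type*} {f : ι → (Fin n → ℂ) → ℂ} {u : ι → ℝ} {c : Fin n → ℂ}
    {r : ℝ} (hr : 0 < r) (hu : Summable u)
    (hf : ∀ i, AnalyticOnNhd ℂ (f i) (closedBall c r))
    (hle : ∀ i, ∀ z ∈ closedBall c r, ‖f i z‖ ≤ u i) :
    AnalyticAt ℂ (fun z => ∑' i, f i z) c := by
  refine analyticAt_of_separately hr ?_ fun z hz j => ?_
  · exact continuousOn_tsum (fun i => (hf i).continuousOn) hu hle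
  · have hupd : ∀ w ∈ ball (c j) r, Function.update z j w ∈ closedBall c r := by
      intro w hw
      rw [mem_closedBall, dist_pi_le_iff hr.le] at *
      intro i
      rcases eq_or_ne i j with rfl | h
      · simpa using le_of_lt hw
      · simpa [h] using hz i
    refine Complex.differentiableOn_tsum_of_summable_norm hu (fun i w hw => ?_) isOpen_ball
      (fun i w hw => hle i _ (hupd w hw))
    refine DifferentiableAt.differentiableWithinAt ?_
    exact ((hf i _ (hupd w hw)).differentiableAt).comp w (hasFDerivAt_update z w).differentiableAt

end

/-! ### The Euler–Maclaurin formula and the theta function -/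

section

open MeasureTheory Polynomial

/-- The Bernoulli kernel `(-1)^k B_k(x) / k!` of the Euler–Maclaurin formula. -/
noncomputable def emKernel (k : ℕ) (x : ℝ) : ℝ := (-1) ^ k * bernoulliFun k x / k.factorial

theorem continuous_emKernel (k : ℕ) : Continuous (emKernel k) := by
  unfold emKernel
  exact (continuous_const.mul (continuous_bernoulliFun k)).div_const _

theorem hasDerivAt_emKernel (k : ℕ) (x : ℝ) : HasDerivAt (emKernel (k + 1)) (-emKernel k x) x := by
  have := ((hasDerivAt_bernoulliFun (k + 1) x).const_mul ((-1 : ℝ) ^ (k + 1))).div_const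
    ((k + 1).factorial : ℝ)
  refine this.congr_deriv ?_
  have h1 : (k.factorial : ℝ) ≠ 0 := by positivity
  have h2 : (k : ℝ) + 1 ≠ 0 := by positivity
  rw [emKernel, Nat.factorial_succ]
  push_cast
  field_simp
  ring

theorem emKernel_zero_right (k : ℕ) : emKernel k 0 = bernoulli' k / k.factorial := by
  rw [emKernel, bernoulliFun_eval_zero, _root_.bernoulli]
  push_cast
  rw [← mul_assoc, ← mul_pow]
  simp

theorem emKernel_one_right {k : ℕ} (hk : k ≠ 1) : emKernel k 1 = emKernel k 0 := by
  rw [emKernel, emKernel, bernoulliFun_endpoints_eq_of_ne_one hk]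

/-- Integration by parts against the Bernoulli kernel on a unit interval. -/
theorem integral_emKernel_succ {g g' : ℝ → ℂ} (hg : ∀ x, HasDerivAt g (g' x) x)
    (hg' : Continuous g') (k : ℕ) :
    ∫ x in (0 : ℝ)..1, (emKernel (k + 1) x : ℂ) * g' x
      = emKernel (k + 1) 1 * g 1 - emKernel (k + 1) 0 * g 0
        + ∫ x in (0 : ℝ)..1, (emKernel k x : ℂ) * g x := by
  have hgc : Continuous g := continuous_iff_continuousAt.2 fun x => (hg x).continuousAt
  rw [intervalIntegral.integral_mul_deriv_eq_deriv_mul (u := fun x => (emKernel (k + 1) x : ℂ))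
    (v := g) (u' := fun x => ((-emKernel k x : ℝ) : ℂ))
    (fun x _ => (hasDerivAt_emKernel k x).ofReal_comp) (fun x _ => hg x)
    (Continuous.intervalIntegrable (Complex.continuous_ofReal.comp (continuous_emKernel k).neg) _ _)
    (hg'.intervalIntegrable _ _)]
  simp only [Complex.ofReal_neg, neg_mul, intervalIntegral.integral_neg, sub_neg_eq_add]

/-- The Euler–Maclaurin formula on a unit interval. -/
theorem euler_maclaurin_unit {g : ℕ → ℝ → ℂ} (hg : ∀ k x, HasDerivAt (g k) (g (k + 1) x) x)
    (J : ℕ) :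
    g 0 1 = (∫ x in (0 : ℝ)..1, g 0 x)
      + ∑ k ∈ Finset.range (J + 1),
          ((bernoulli' (k + 1) : ℂ) / (k + 1).factorial) * (g k 1 - g k 0)
      - ∫ x in (0 : ℝ)..1, (emKernel (J + 1) x : ℂ) * g (J + 1) x := by
  have hcont : ∀ k, Continuous (g k) := fun k =>
    continuous_iff_continuousAt.2 fun x => (hg k x).continuousAt
  have hz : ∀ k, (emKernel k 0 : ℂ) = (bernoulli' k : ℂ) / k.factorial := by
    intro k
    rw [emKernel_zero_right]
    push_cast
    rfl
  induction J with
  | zero =>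
    rw [integral_emKernel_succ (hg 0) (hcont 1)]
    simp [emKernel, bernoulliFun_zero, bernoulliFun_one]
    ring
  | succ J ih =>
    rw [Finset.sum_range_succ, integral_emKernel_succ (hg (J + 1)) (hcont _),
      emKernel_one_right (by omega), hz]
    linear_combination ih

/-- The Euler–Maclaurin formula on `[0, N]`. -/
theorem euler_maclaurin_finite {f : ℕ → ℝ → ℂ} (hf : ∀ k x, HasDerivAt (f k) (f (k + 1) x) x)
    (J N : ℕ) :
    ∑ m ∈ Finset.range N, f 0 (m + 1) = (∫ x in (0 : ℝ)..N, f 0 x)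
      + ∑ k ∈ Finset.range (J + 1),
          ((bernoulli' (k + 1) : ℂ) / (k + 1).factorial) * (f k N - f k 0)
      - ∑ m ∈ Finset.range N, ∫ x in (0 : ℝ)..1, (emKernel (J + 1) x : ℂ) * f (J + 1) (m + x) := by
  have hcont : ∀ k, Continuous (f k) := fun k =>
    continuous_iff_continuousAt.2 fun x => (hf k x).continuousAt
  induction N with
  | zero => simp
  | succ N ih =>
    have h1 := euler_maclaurin_unit (g := fun k x => f k (N + x))
      (fun k x => by simpa using (hf k (N + x)).comp_const_add (N : ℝ) x) J
    rw [Finset.sum_range_succ _ N, Finset.sum_range_succ _ N, ih, h1]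
    have h2 : (∫ x in (0 : ℝ)..N, f 0 x) + ∫ x in (0 : ℝ)..1, f 0 (N + x)
        = ∫ x in (0 : ℝ)..((N + 1 : ℕ) : ℝ), f 0 x := by
      rw [intervalIntegral.integral_comp_add_left (fun x => f 0 x) (N : ℝ), add_zero,
        intervalIntegral.integral_add_adjacent_intervals ((hcont 0).intervalIntegrable _ _)
        ((hcont 0).intervalIntegrable _ _)]
      push_cast
      rfl
    rw [← h2]
    push_cast
    simp only [mul_sub, Finset.sum_sub_distrib, add_zero]
    ring

/-- The Euler–Maclaurin formula on `[0, ∞)`, with the error estimated by the `L¹` norm of the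
derivative of order `J + 1`. -/
theorem euler_maclaurin_bound (J : ℕ) : ∃ C : ℝ, 0 ≤ C ∧ ∀ f : ℕ → ℝ → ℂ,
    (∀ k x, HasDerivAt (f k) (f (k + 1) x) x) →
    (∀ k, IntegrableOn (f k) (Set.Ioi 0)) → (∀ k, Tendsto (f k) atTop (𝓝 0)) →
    Summable (fun m : ℕ => f 0 (m + 1)) →
    ‖(∑' m : ℕ, f 0 (m + 1)) - ((∫ x in Set.Ioi (0 : ℝ), f 0 x)
      - ∑ k ∈ Finset.range (J + 1), ((bernoulli' (k + 1) : ℂ) / (k + 1).factorial) * f k 0)‖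
      ≤ C * ∫ x in Set.Ioi (0 : ℝ), ‖f (J + 1) x‖ := by
  obtain ⟨C, hC⟩ := (isCompact_Icc (a := (0 : ℝ)) (b := 1)).exists_bound_of_continuousOn
    (continuous_emKernel (J + 1)).continuousOn
  have hC0 : 0 ≤ C := (norm_nonneg _).trans (hC 0 (by simp))
  refine ⟨C, hC0, fun f hf hint hlim hsum => ?_⟩
  have hcont : ∀ k, Continuous (f k) := fun k =>
    continuous_iff_continuousAt.2 fun x => (hf k x).continuousAt
  have hN : Tendsto (fun N : ℕ => (N : ℝ)) atTop atTop := tendsto_natCast_atTop_atTop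
  have hT : Tendsto (fun N : ℕ => (∑ m ∈ Finset.range N, f 0 (m + 1)) - ((∫ x in (0 : ℝ)..N, f 0 x)
      + ∑ k ∈ Finset.range (J + 1),
          ((bernoulli' (k + 1) : ℂ) / (k + 1).factorial) * (f k N - f k 0))) atTop
      (𝓝 ((∑' m : ℕ, f 0 (m + 1)) - ((∫ x in Set.Ioi (0 : ℝ), f 0 x)
      + ∑ k ∈ Finset.range (J + 1),
          ((bernoulli' (k + 1) : ℂ) / (k + 1).factorial) * (0 - f k 0)))) := by
    refine hsum.hasSum.tendsto_sum_nat.sub (Tendsto.add ?_ ?_)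
    · exact intervalIntegral_tendsto_integral_Ioi 0 (hint 0) hN
    · exact tendsto_finsetSum _ fun k _ => (((hlim k).comp hN).sub_const _).const_mul _
  simp only [zero_sub, mul_neg, Finset.sum_neg_distrib, ← sub_eq_add_neg] at hT
  refine le_of_tendsto hT.norm (Eventually.of_forall fun N => ?_)
  rw [euler_maclaurin_finite hf J N, sub_sub_cancel_left, norm_neg]
  have hfi : ∀ a b : ℝ, IntervalIntegrable (fun x => ‖f (J + 1) x‖) volume a b :=
    fun a b => (hcont _).norm.intervalIntegrable _ _
  calc ‖∑ m ∈ Finset.range N, ∫ x in (0 : ℝ)..1, (emKernel (J + 1) x : ℂ) * f (J + 1) (m + x)‖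
      ≤ ∑ m ∈ Finset.range N, C * ∫ x in (m : ℝ)..((m + 1 : ℕ) : ℝ), ‖f (J + 1) x‖ := by
        refine norm_sum_le_of_le _ fun m _ => ?_
        have h2 : ∫ x in (m : ℝ)..((m + 1 : ℕ) : ℝ), ‖f (J + 1) x‖
            = ∫ x in (0 : ℝ)..1, ‖f (J + 1) (m + x)‖ := by
          rw [intervalIntegral.integral_comp_add_left (fun x => ‖f (J + 1) x‖) (m : ℝ)]
          simp
        rw [h2, ← intervalIntegral.integral_const_mul]
        refine intervalIntegral.norm_integral_le_of_norm_le zero_le_one ?_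
          (Continuous.intervalIntegrable (by have := hcont (J + 1); fun_prop) _ _)
        refine Eventually.of_forall fun x hx => ?_
        rw [norm_mul]
        refine mul_le_mul_of_nonneg_right ?_ (norm_nonneg _)
        simpa using hC x ⟨hx.1.le, hx.2⟩
    _ = C * ∫ x in (0 : ℝ)..N, ‖f (J + 1) x‖ := by
        rw [← Finset.mul_sum, intervalIntegral.sum_integral_adjacent_intervals
          (a := fun m : ℕ => (m : ℝ)) (fun k _ => hfi _ _)]
        simp
    _ ≤ C * ∫ x in Set.Ioi (0 : ℝ), ‖f (J + 1) x‖ := by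
        refine mul_le_mul_of_nonneg_left ?_ hC0
        rw [intervalIntegral.integral_of_le (Nat.cast_nonneg N)]
        exact setIntegral_mono_set (hint (J + 1)).norm
          (Eventually.of_forall fun x => norm_nonneg _) Set.Ioc_subset_Ioi_self.eventuallyLE

/-- The polynomials `p_k` with `(d/dx)^k exp(-γ x^d) = p_k(x) exp(-γ x^d)`. -/
noncomputable def expDerivPoly (d : ℕ) (γ : ℂ) : ℕ → ℂ[X]
  | 0 => 1
  | k + 1 => derivative (expDerivPoly d γ k) - C (γ * d) * X ^ (d - 1) * expDerivPoly d γ k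

/-- The Taylor series of `exp(-γ x^d)` at the origin. -/
noncomputable def expPowSeries (d : ℕ) (γ : ℂ) : PowerSeries ℂ :=
  PowerSeries.mk fun j => if d ∣ j then (-γ) ^ (j / d) / (j / d).factorial else 0

theorem derivative_expPowSeries {d : ℕ} (hd : 0 < d) (γ : ℂ) :
    PowerSeries.derivative ℂ (expPowSeries d γ)
      = -(PowerSeries.C (γ * d) * PowerSeries.X ^ (d - 1) * expPowSeries d γ) := by
  ext j
  rw [PowerSeries.coeff_derivative, map_neg, mul_assoc, PowerSeries.coeff_C_mul,
    PowerSeries.coeff_X_pow_mul']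
  simp only [expPowSeries, PowerSeries.coeff_mk]
  by_cases h : d ∣ j + 1
  · obtain ⟨i, hi⟩ := h
    rcases i with _ | i
    · omega
    have hi' : j + 1 = d * i + d := by rw [hi]; ring
    have h1 : j - (d - 1) = d * i := by omega
    have h0 : d - 1 ≤ j := by have := Nat.zero_le (d * i); omega
    rw [if_pos h0, h1, if_pos ⟨_, hi⟩, if_pos ⟨_, rfl⟩, hi, Nat.mul_div_cancel_left _ hd,
      Nat.mul_div_cancel_left _ hd]
    have h2 : (j : ℂ) + 1 = d * (i + 1) := by exact_mod_cast hi
    rw [h2, Nat.factorial_succ]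
    have h3 : (i.factorial : ℂ) ≠ 0 := by exact_mod_cast i.factorial_ne_zero
    have h4 : (i : ℂ) + 1 ≠ 0 := by exact_mod_cast i.succ_ne_zero
    push_cast
    field_simp
    ring
  · rw [if_neg h, zero_mul]
    split_ifs with h1 h2
    · obtain ⟨i, hi⟩ := h2
      exact absurd ⟨i + 1, by rw [mul_add, mul_one, ← hi]; omega⟩ h
    · simp
    · simp

/-- The identity `p_k(x) exp(-γ x^d) = (d/dx)^k exp(-γ x^d)` for formal power series. -/
theorem expDerivPoly_mul_expPowSeries {d : ℕ} (hd : 0 < d) (γ : ℂ) (k : ℕ) :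
    (expDerivPoly d γ k : PowerSeries ℂ) * expPowSeries d γ
      = (PowerSeries.derivative ℂ)^[k] (expPowSeries d γ) := by
  induction k with
  | zero => simp [expDerivPoly]
  | succ k ih =>
    rw [Function.iterate_succ_apply', ← ih, Derivation.leibniz, derivative_expPowSeries hd,
      PowerSeries.derivative_coe, expDerivPoly]
    push_cast
    simp only [smul_eq_mul]
    ring

theorem coeff_iterate_derivative (A : PowerSeries ℂ) (k j : ℕ) :
    PowerSeries.coeff j ((PowerSeries.derivative ℂ)^[k] A) * j.factorial
      = PowerSeries.coeff (j + k) A * (j + k).factorial := by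
  induction k generalizing j with
  | zero => simp
  | succ k ih =>
    rw [Function.iterate_succ_apply', PowerSeries.coeff_derivative]
    have := ih (j + 1)
    rw [Nat.factorial_succ j] at this
    push_cast at this
    rw [show j + (k + 1) = j + 1 + k by ring, ← this]
    ring

theorem expDerivPoly_eval_zero {d : ℕ} (hd : 0 < d) (γ : ℂ) (k : ℕ) :
    (expDerivPoly d γ k).eval 0
      = if d ∣ k then k.factorial * ((-γ) ^ (k / d) / (k / d).factorial) else 0 := by
  have h := congrArg (PowerSeries.coeff 0) (expDerivPoly_mul_expPowSeries hd γ k)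
  have h2 := coeff_iterate_derivative (expPowSeries d γ) k 0
  simp only [Nat.factorial_zero, Nat.cast_one, mul_one, zero_add] at h2
  rw [h2, PowerSeries.coeff_zero_eq_constantCoeff_apply, map_mul,
    ← PowerSeries.coeff_zero_eq_constantCoeff_apply,
    ← PowerSeries.coeff_zero_eq_constantCoeff_apply] at h
  simp only [Polynomial.coeff_coe, expPowSeries, PowerSeries.coeff_mk, dvd_zero, if_true,
    Nat.zero_div, pow_zero, Nat.factorial_zero,
    Nat.cast_one, div_one, mul_one] at h
  rw [← Polynomial.coeff_zero_eq_eval_zero, h]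
  split_ifs <;> ring

theorem hasDerivAt_expDeriv {d : ℕ} (γ : ℂ) (k : ℕ) (x : ℝ) :
    HasDerivAt (fun x : ℝ => (expDerivPoly d γ k).eval (x : ℂ) * Complex.exp (-γ * (x : ℂ) ^ d))
      ((expDerivPoly d γ (k + 1)).eval (x : ℂ) * Complex.exp (-γ * (x : ℂ) ^ d)) x := by
  have h1 := (expDerivPoly d γ k).hasDerivAt (x : ℂ)
  have h2 := (((hasDerivAt_pow d (x : ℂ)).const_mul (-γ))).cexp
  refine (h1.mul h2).comp_ofReal.congr_deriv ?_
  simp only [expDerivPoly, eval_sub, eval_mul, eval_C, eval_pow, eval_X]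
  ring

theorem isBigO_polynomial_mul_exp {d : ℕ} (hd : 0 < d) {γ : ℂ} (hγ : 0 < γ.re) (p : ℂ[X]) :
    (fun x : ℝ => p.eval (x : ℂ) * Complex.exp (-γ * (x : ℂ) ^ d))
      =O[atTop] fun x : ℝ => Real.exp (-(γ.re / 2) * x) := by
  induction p using Polynomial.induction_on' with
  | add p q hp hq =>
    simp only [eval_add, add_mul]
    exact hp.add hq
  | monomial n a =>
    simp only [eval_monomial, mul_assoc]
    refine Asymptotics.IsBigO.const_mul_left ?_ a
    have h1 := (isLittleO_pow_exp_pos_mul_atTop n (half_pos hγ)).isBigO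
    have h2 : (fun x : ℝ => Complex.exp (-γ * (x : ℂ) ^ d))
        =O[atTop] fun x : ℝ => Real.exp (-γ.re * x) := by
      refine Asymptotics.IsBigO.of_bound 1 ?_
      filter_upwards [eventually_ge_atTop 1] with x hx
      rw [Complex.norm_exp, one_mul, Real.norm_of_nonneg (Real.exp_pos _).le, Real.exp_le_exp,
        ← Complex.ofReal_pow, Complex.re_mul_ofReal, Complex.neg_re]
      have : x ≤ x ^ d := le_self_pow₀ hx hd.ne'
      nlinarith
    have h3 : (fun x : ℝ => (x : ℂ) ^ n) =O[atTop] fun x : ℝ => x ^ n :=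
      Asymptotics.IsBigO.of_bound 1 (Eventually.of_forall fun x => by simp)
    refine ((h3.trans h1).mul h2).congr_right fun x => ?_
    rw [← Real.exp_add]
    congr 1
    ring

theorem integrableOn_polynomial_mul_exp {d : ℕ} (hd : 0 < d) {γ : ℂ} (hγ : 0 < γ.re) (p : ℂ[X]) :
    IntegrableOn (fun x : ℝ => p.eval (x : ℂ) * Complex.exp (-γ * (x : ℂ) ^ d)) (Set.Ioi 0) := by
  have hc : Continuous (fun x : ℝ => p.eval (x : ℂ) * Complex.exp (-γ * (x : ℂ) ^ d)) := by fun_prop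
  rw [IntegrableOn, ← integrable_norm_iff hc.aestronglyMeasurable]
  exact integrable_of_isBigO_exp_neg (half_pos hγ) hc.norm.continuousOn
    (isBigO_polynomial_mul_exp hd hγ p).norm_left

theorem tendsto_polynomial_mul_exp {d : ℕ} (hd : 0 < d) {γ : ℂ} (hγ : 0 < γ.re) (p : ℂ[X]) :
    Tendsto (fun x : ℝ => p.eval (x : ℂ) * Complex.exp (-γ * (x : ℂ) ^ d)) atTop (𝓝 0) := by
  refine (isBigO_polynomial_mul_exp hd hγ p).trans_tendsto ?_
  refine Real.tendsto_exp_atBot.comp ?_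
  exact tendsto_id.const_mul_atTop_of_neg (by linarith)

/-- The theta function `∑_{m ≥ 1} exp(-γ m^d t)`. -/
noncomputable def theta (d : ℕ) (γ : ℂ) (t : ℝ) : ℂ :=
  ∑' m : ℕ+, Complex.exp (-γ * ((m : ℕ) : ℂ) ^ d * t)

/-- The coefficient of `t^i` in the asymptotic expansion of `theta` at the origin. -/
noncomputable def thetaCoeff (d : ℕ) (γ : ℂ) (i : ℕ) : ℂ :=
  -((bernoulli' (d * i + 1) : ℂ) / (d * i + 1 : ℕ)) * ((-γ) ^ i / i.factorial)

/-- The coefficient of `t^{-1/d}` in the asymptotic expansion of `theta` at the origin. -/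
noncomputable def thetaLead (d : ℕ) (γ : ℂ) : ℂ :=
  ∫ x in Set.Ioi (0 : ℝ), Complex.exp (-γ * (x : ℂ) ^ d)

/-- The remainder of the asymptotic expansion of `theta` at the origin. -/
noncomputable def thetaRem (d : ℕ) (γ : ℂ) (K : ℕ) (t : ℝ) : ℂ :=
  theta d γ t - (thetaLead d γ * ((t ^ (-(1 / (d : ℝ))) : ℝ) : ℂ)
    + ∑ i ∈ Finset.range K, thetaCoeff d γ i * (t : ℂ) ^ i)

theorem norm_exp_theta (d : ℕ) (γ : ℂ) {t : ℝ} (x : ℝ) :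
    ‖Complex.exp (-γ * (x : ℂ) ^ d * t)‖ = Real.exp (-γ.re * x ^ d * t) := by
  rw [Complex.norm_exp, ← Complex.ofReal_pow, Complex.re_mul_ofReal, Complex.re_mul_ofReal,
    Complex.neg_re]

theorem summable_exp_theta {d : ℕ} (hd : 0 < d) {γ : ℂ} (hγ : 0 < γ.re) {t : ℝ} (ht : 0 < t) :
    Summable fun m : ℕ => Complex.exp (-γ * ((m : ℝ) : ℂ) ^ d * t) := by
  have hg : Summable fun m : ℕ => Real.exp (m * (-(γ.re * t))) :=
    Real.summable_exp_nat_mul_iff.2 (by nlinarith [mul_pos hγ ht])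
  refine Summable.of_norm_bounded hg fun m => ?_
  rw [norm_exp_theta, Real.exp_le_exp]
  have : (m : ℝ) ≤ (m : ℝ) ^ d := by exact_mod_cast Nat.le_self_pow hd.ne' m
  nlinarith [mul_pos hγ ht, mul_le_mul_of_nonneg_left this (mul_pos hγ ht).le]

/-- The error in the expansion of `theta` at the origin; the bound holds for all `t > 0`. -/
theorem norm_thetaRem_le {d : ℕ} (hd : 0 < d) {γ : ℂ} (hγ : 0 < γ.re) (K : ℕ) :
    ∃ C : ℝ, 0 ≤ C ∧ ∀ t : ℝ, 0 < t → ‖thetaRem d γ K t‖ ≤ C * t ^ K := by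
  obtain ⟨C, hC0, hC⟩ := euler_maclaurin_bound (d * K)
  -- Euler–Maclaurin of order `d * K + 1` has error of order `ε^{d K} = t^K`; the term `i = K` of
  -- its main part is of the same size and is moved to the error
  let G : ℕ → ℝ → ℂ := fun k x => (expDerivPoly d γ k).eval (x : ℂ) * Complex.exp (-γ * (x : ℂ) ^ d)
  let M := ∫ x in Set.Ioi (0 : ℝ), ‖G (d * K + 1) x‖
  have hM : 0 ≤ M := integral_nonneg fun _ => norm_nonneg _
  refine ⟨C * M + ‖thetaCoeff d γ K‖, by positivity, fun t ht => ?_⟩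
  -- the substitution `x ↦ ε x` with `ε = t^{1/d}` turns `exp(-γ x^d)` into `exp(-γ x^d t)`
  set ε : ℝ := t ^ (1 / (d : ℝ)) with hε
  have hε0 : 0 < ε := Real.rpow_pos_of_pos ht _
  have hεd : ε ^ d = t := by
    rw [hε, ← Real.rpow_natCast, ← Real.rpow_mul ht.le, one_div_mul_cancel (by positivity),
      Real.rpow_one]
  have hεinv : t ^ (-(1 / (d : ℝ))) = ε⁻¹ := Real.rpow_neg ht.le _
  let f : ℕ → ℝ → ℂ := fun k x => (ε : ℂ) ^ k * G k (ε * x)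
  have hf0 : ∀ x, f 0 x = Complex.exp (-γ * (x : ℂ) ^ d * t) := by
    intro x
    simp only [f, G, expDerivPoly, pow_zero, one_mul, Polynomial.eval_one]
    rw [← hεd]
    push_cast
    ring_nf
  have hderiv : ∀ k x, HasDerivAt (f k) (f (k + 1) x) x := by
    intro k x
    have h1 := (hasDerivAt_expDeriv (d := d) γ k (ε * x)).scomp x
      ((hasDerivAt_id x).const_mul ε)
    have h2 := h1.const_mul ((ε : ℂ) ^ k)
    refine h2.congr_deriv ?_
    simp only [f, G, mul_one, Complex.real_smul]
    ring
  have hfint : ∀ k, IntegrableOn (f k) (Set.Ioi 0) := by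
    intro k
    have := (integrableOn_Ioi_comp_mul_left_iff (G k) 0 hε0).2
      (by simpa [G] using integrableOn_polynomial_mul_exp hd hγ (expDerivPoly d γ k))
    exact this.const_mul _
  have hflim : ∀ k, Tendsto (f k) atTop (𝓝 0) := by
    intro k
    have := ((tendsto_polynomial_mul_exp hd hγ (expDerivPoly d γ k)).comp
      (tendsto_id.const_mul_atTop hε0)).const_mul ((ε : ℂ) ^ k)
    simpa [f, G, Function.comp_def] using this
  have hs : Summable fun m : ℕ => f 0 (m + 1) := by
    have := (summable_nat_add_iff 1).2 (summable_exp_theta hd hγ ht)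
    refine this.congr fun m => ?_
    rw [hf0]
    push_cast
    rfl
  have key := hC f hderiv hfint hflim hs
  have e1 : ∑' m : ℕ, f 0 (m + 1) = theta d γ t := by
    rw [theta, tsum_pnat_eq_tsum_succ (f := fun m : ℕ => Complex.exp (-γ * (m : ℂ) ^ d * t))]
    refine tsum_congr fun m => ?_
    rw [hf0]
    push_cast
    rfl
  have e2 : ∫ x in Set.Ioi (0 : ℝ), f 0 x = thetaLead d γ * ((t ^ (-(1 / (d : ℝ))) : ℝ) : ℂ) := by
    have : ∀ x, f 0 x = G 0 (ε * x) := fun x => by simp [f]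
    simp only [this]
    rw [integral_comp_mul_left_Ioi (G 0) 0 hε0, mul_zero, hεinv, Complex.real_smul, mul_comm]
    congr 1
    simp [G, thetaLead, expDerivPoly]
  have e3 : ∫ x in Set.Ioi (0 : ℝ), ‖f (d * K + 1) x‖ = M * t ^ K := by
    have : ∀ x, ‖f (d * K + 1) x‖ = ε ^ (d * K + 1) * ‖G (d * K + 1) (ε * x)‖ := by
      intro x
      simp [f, abs_of_pos hε0]
    simp only [this]
    rw [integral_const_mul, integral_comp_mul_left_Ioi (fun x => ‖G (d * K + 1) x‖) 0 hε0, mul_zero,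
      smul_eq_mul, pow_succ, pow_mul, hεd]
    change t ^ K * ε * (ε⁻¹ * M) = M * t ^ K
    field_simp
  have e4 : ∑ k ∈ Finset.range (d * K + 1), ((bernoulli' (k + 1) : ℂ) / (k + 1).factorial) * f k 0
      = -∑ i ∈ Finset.range (K + 1), thetaCoeff d γ i * (t : ℂ) ^ i := by
    have hval : ∀ k, f k 0 = (ε : ℂ) ^ k
        * if d ∣ k then k.factorial * ((-γ) ^ (k / d) / (k / d).factorial) else 0 := by
      intro k
      simp only [f, G, mul_zero, Complex.ofReal_zero, zero_pow hd.ne', Complex.exp_zero, mul_one]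
      rw [expDerivPoly_eval_zero hd]
    rw [← Finset.sum_neg_distrib]
    symm
    refine Finset.sum_of_injOn (fun i => d * i) (fun i _ j _ h => Nat.eq_of_mul_eq_mul_left hd h)
      ?_ ?_ ?_
    · intro i hi
      simp only [Finset.coe_range, Set.mem_Iio] at hi ⊢
      have := Nat.mul_le_mul_left d (Nat.lt_succ_iff.1 hi)
      omega
    · intro k hk hk'
      rw [hval, if_neg, mul_zero, mul_zero]
      rintro ⟨i, rfl⟩
      refine hk' ⟨i, ?_, rfl⟩
      simp only [Finset.coe_range, Set.mem_Iio, Finset.mem_range] at hk ⊢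
      exact Nat.lt_succ_of_le (Nat.le_of_mul_le_mul_left (Nat.lt_succ_iff.1 hk) hd)
    · intro i _
      rw [hval, if_pos ⟨i, rfl⟩, Nat.mul_div_cancel_left _ hd, thetaCoeff, pow_mul]
      have h5 : (ε : ℂ) ^ d = t := by exact_mod_cast hεd
      rw [h5, Nat.factorial_succ]
      have h3 : ((d * i).factorial : ℂ) ≠ 0 := by exact_mod_cast (d * i).factorial_ne_zero
      have h4 : (d : ℂ) * i + 1 ≠ 0 := by exact_mod_cast (d * i).succ_ne_zero
      push_cast
      field_simp
  rw [e1, e2, e3, e4, sub_neg_eq_add, Finset.sum_range_succ] at key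
  have hrem : thetaRem d γ K t = (theta d γ t - (thetaLead d γ * ((t ^ (-(1 / (d : ℝ))) : ℝ) : ℂ)
      + (∑ i ∈ Finset.range K, thetaCoeff d γ i * (t : ℂ) ^ i + thetaCoeff d γ K * (t : ℂ) ^ K)))
      + thetaCoeff d γ K * (t : ℂ) ^ K := by
    rw [thetaRem]; ring
  rw [hrem]
  refine (norm_add_le _ _).trans ?_
  rw [add_mul, norm_mul, norm_pow, Complex.norm_real, Real.norm_of_nonneg ht.le, mul_assoc]
  gcongr

end

/-! ### Mellin transforms -/

section

open MeasureTheory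

theorem integrableOn_rpow_mul_exp {σ b : ℝ} (hσ : 0 < σ) (hb : 0 < b) :
    IntegrableOn (fun t : ℝ => t ^ (σ - 1) * Real.exp (-b * t)) (Set.Ioi 0) := by
  simpa using integrableOn_rpow_mul_exp_neg_mul_rpow (p := 1) (s := σ - 1) (by linarith) one_pos hb

theorem norm_cpow_mul_exp {s r : ℂ} {t : ℝ} (ht : 0 < t) :
    ‖(t : ℂ) ^ (s - 1) * Complex.exp (-r * t)‖ = t ^ (s.re - 1) * Real.exp (-r.re * t) := by
  rw [norm_mul, Complex.norm_cpow_eq_rpow_re_of_pos ht, Complex.norm_exp, Complex.re_mul_ofReal]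
  simp

theorem continuousOn_cpow_mul_exp (s r : ℂ) :
    ContinuousOn (fun t : ℝ => (t : ℂ) ^ (s - 1) * Complex.exp (-r * t)) (Set.Ioi 0) := by
  refine ContinuousOn.mul (fun t ht => ?_) (by fun_prop)
  exact ((Complex.continuousAt_ofReal_cpow_const t _ (Or.inr (ne_of_gt ht)))).continuousWithinAt

theorem integrableOn_cpow_mul_exp {s r : ℂ} (hs : 0 < s.re) (hr : 0 < r.re) :
    IntegrableOn (fun t : ℝ => (t : ℂ) ^ (s - 1) * Complex.exp (-r * t)) (Set.Ioi 0) := by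
  refine (integrableOn_rpow_mul_exp hs hr).mono'
    ((continuousOn_cpow_mul_exp s r).aestronglyMeasurable measurableSet_Ioi) ?_
  refine (ae_restrict_iff' measurableSet_Ioi).2 (Eventually.of_forall fun t ht => ?_)
  rw [norm_cpow_mul_exp ht]

theorem mellinConvergent_exp {s r : ℂ} (hs : 0 < s.re) (hr : 0 < r.re) :
    MellinConvergent (fun t : ℝ => Complex.exp (-r * t)) s :=
  integrableOn_cpow_mul_exp hs hr

theorem differentiableOn_mellin_exp {s : ℂ} (hs : 0 < s.re) :
    DifferentiableOn ℂ (fun r : ℂ => mellin (fun t : ℝ => Complex.exp (-r * t)) s)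
      {r : ℂ | 0 < r.re} := by
  intro r₀ hr₀
  have hr₀' : 0 < r₀.re := hr₀
  have hs1 : 0 < (s + 1).re := by simp; linarith
  refine DifferentiableAt.differentiableWithinAt ?_
  have hball : ∀ r ∈ Metric.ball r₀ (r₀.re / 2), r₀.re / 2 < r.re := by
    intro r hr
    have h1 := (Complex.abs_re_le_norm (r - r₀)).trans_lt (mem_ball_iff_norm.1 hr)
    rw [Complex.sub_re] at h1
    linarith [abs_lt.1 h1]
  refine (hasDerivAt_integral_of_dominated_loc_of_deriv_le (𝕜 := ℂ)
    (μ := volume.restrict (Set.Ioi (0 : ℝ)))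
    (F := fun r t => (t : ℂ) ^ (s - 1) • Complex.exp (-r * t))
    (F' := fun r t => (t : ℂ) ^ (s - 1) * (Complex.exp (-r * t) * (-1 * (t : ℂ))))
    (bound := fun t => t ^ ((s + 1).re - 1) * Real.exp (-(r₀.re / 2) * t))
    (Metric.ball_mem_nhds r₀ (half_pos hr₀')) ?_ (integrableOn_cpow_mul_exp hs hr₀) ?_ ?_
    (integrableOn_rpow_mul_exp hs1 (half_pos hr₀')) ?_).2.differentiableAt
  · exact Eventually.of_forall fun r =>
      (continuousOn_cpow_mul_exp s r).aestronglyMeasurable measurableSet_Ioi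
  · have : ContinuousOn (fun t : ℝ => (t : ℂ) ^ (s - 1) * (Complex.exp (-r₀ * t) * (-1 * (t : ℂ))))
        (Set.Ioi 0) := by
      simp only [← mul_assoc]
      exact ((continuousOn_cpow_mul_exp s r₀).mul continuousOn_const).mul (by fun_prop)
    exact this.aestronglyMeasurable measurableSet_Ioi
  · refine (ae_restrict_iff' measurableSet_Ioi).2 (Eventually.of_forall fun t ht r hr => ?_)
    have ht' : 0 < t := ht
    rw [← mul_assoc, norm_mul, norm_cpow_mul_exp ht']
    have h1 : ‖(-1 * (t : ℂ))‖ = t := by simp [abs_of_pos ht']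
    rw [h1, Complex.add_re, Complex.one_re, add_sub_cancel_right]
    have h2 : t ^ s.re = t ^ (s.re - 1) * t := by
      rw [← Real.rpow_add_one ht'.ne', sub_add_cancel]
    rw [h2]
    have h3 : Real.exp (-r.re * t) ≤ Real.exp (-(r₀.re / 2) * t) := by
      rw [Real.exp_le_exp]
      nlinarith [hball r hr]
    have h4 : 0 < t ^ (s.re - 1) := Real.rpow_pos_of_pos ht' _
    nlinarith [mul_pos h4 ht', mul_le_mul_of_nonneg_left h3 (mul_pos h4 ht').le]
  · refine Eventually.of_forall fun t r _ => ?_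
    have h1 : HasDerivAt (fun r : ℂ => -r * (t : ℂ)) (-1 * (t : ℂ)) r :=
      (hasDerivAt_neg r).mul_const (t : ℂ)
    exact h1.cexp.const_mul ((t : ℂ) ^ (s - 1))

/-- The Mellin transform of `exp(-r t)` is `Γ(s) r^{-s}`, for `r` in the right half plane. -/
theorem mellin_exp {s r : ℂ} (hs : 0 < s.re) (hr : 0 < r.re) :
    mellin (fun t : ℝ => Complex.exp (-r * t)) s = Complex.Gamma s * r ^ (-s) := by
  have hopen : IsOpen {r : ℂ | 0 < r.re} := isOpen_lt continuous_const Complex.continuous_re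
  have hconv : Convex ℝ {r : ℂ | 0 < r.re} := convex_halfSpace_re_gt 0
  have h1 := (differentiableOn_mellin_exp hs).analyticOnNhd hopen
  have h2 : AnalyticOnNhd ℂ (fun r : ℂ => Complex.Gamma s * r ^ (-s)) {r : ℂ | 0 < r.re} := by
    refine DifferentiableOn.analyticOnNhd (fun r hr => ?_) hopen
    exact ((differentiableAt_id.cpow_const (Or.inl hr)).const_mul _).differentiableWithinAt
  have hreal : ∀ x : ℝ, 0 < x → mellin (fun t : ℝ => Complex.exp (-(x : ℂ) * t)) s
      = Complex.Gamma s * (x : ℂ) ^ (-s) := by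
    intro x hx
    have := Complex.integral_cpow_mul_exp_neg_mul_Ioi hs hx
    simp only [mellin, smul_eq_mul, neg_mul]
    rw [this, one_div, Complex.inv_cpow _ _ (by
      rw [Complex.arg_ofReal_of_nonneg hx.le]; exact Real.pi_pos.ne), Complex.cpow_neg, mul_comm]
  have hfreq : ∃ᶠ r in 𝓝[≠] ((1 : ℝ) : ℂ),
      mellin (fun t : ℝ => Complex.exp (-r * t)) s = Complex.Gamma s * r ^ (-s) := by
    have ht : Tendsto (fun x : ℝ => (x : ℂ)) (𝓝[≠] 1) (𝓝[≠] ((1 : ℝ) : ℂ)) := by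
      refine tendsto_nhdsWithin_of_tendsto_nhds_of_eventually_within _
        (Complex.continuous_ofReal.continuousAt.tendsto.mono_left nhdsWithin_le_nhds) ?_
      filter_upwards [self_mem_nhdsWithin] with x hx
      simpa using hx
    refine ht.frequently (Eventually.frequently ?_)
    filter_upwards [nhdsWithin_le_nhds (lt_mem_nhds one_pos)] with x hx using hreal x hx
  -- both sides are holomorphic in `r` and agree for real `r`
  exact h1.eqOn_of_preconnected_of_frequently_eq h2 hconv.isPreconnected
    (by simp) hfreq hr

theorem inv_Gamma_eq_ascPochhammer (s : ℂ) (i : ℕ) :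
    (Complex.Gamma s)⁻¹ = (ascPochhammer ℂ i).eval s * (Complex.Gamma (s + i))⁻¹ := by
  induction i with
  | zero => simp
  | succ i ih =>
    rw [ih, ascPochhammer_succ_eval,
      Complex.one_div_Gamma_eq_self_mul_one_div_Gamma_add_one (s + i)]
    push_cast
    ring_nf

/-- `Γ(s + i) / Γ(s) = s (s + 1) ⋯ (s + i - 1)`; at the poles of `Γ(s)` both sides vanish, the value
of `Γ` in Mathlib being zero there. -/
theorem inv_Gamma_mul_Gamma_add {s : ℂ} {i : ℕ} (h : 0 < (s + i).re) :
    (Complex.Gamma s)⁻¹ * Complex.Gamma (s + i) = (ascPochhammer ℂ i).eval s := by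
  rw [inv_Gamma_eq_ascPochhammer s i, mul_assoc, inv_mul_cancel₀
    (Complex.Gamma_ne_zero_of_re_pos h), mul_one]

variable {d : ℕ} {γ : ℂ}

theorem continuousOn_theta (hd : 0 < d) (hγ : 0 < γ.re) : ContinuousOn (theta d γ) (Set.Ioi 0) := by
  intro δ hδ
  have hδ' : 0 < δ := hδ
  have hs : Summable fun m : ℕ+ => Real.exp (-γ.re * ((m : ℕ) : ℝ) ^ d * (δ / 2)) := by
    have := (summable_exp_theta hd hγ (half_pos hδ')).norm.comp_injective PNat.coe_injective
    refine this.congr fun m => ?_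
    simp only [Function.comp_apply]
    rw [norm_exp_theta]
  have : ContinuousOn (theta d γ) (Set.Ici (δ / 2)) := by
    refine continuousOn_tsum (fun m => by fun_prop) hs fun m t ht => ?_
    have h1 := norm_exp_theta d γ (t := t) ((m : ℕ) : ℝ)
    rw [Complex.ofReal_natCast] at h1
    rw [h1, Real.exp_le_exp]
    have h2 : 0 < γ.re * ((m : ℕ) : ℝ) ^ d := by have := m.pos; positivity
    have h3 : δ / 2 ≤ t := ht
    nlinarith
  exact (this.continuousAt (Ici_mem_nhds (by linarith))).continuousWithinAt

theorem continuousOn_thetaRem (hd : 0 < d) (hγ : 0 < γ.re) (K : ℕ) :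
    ContinuousOn (thetaRem d γ K) (Set.Ioi 0) := by
  refine (continuousOn_theta hd hγ).sub (ContinuousOn.add (continuousOn_const.mul ?_) (by fun_prop))
  refine Complex.continuous_ofReal.comp_continuousOn ?_
  exact continuousOn_id.rpow_const fun t ht => Or.inl (ne_of_gt ht)

/-- The Mellin transform of `exp(-A t)` times the remainder of the expansion of `theta`. -/
noncomputable def remMellin (d : ℕ) (γ : ℂ) (K : ℕ) (s A : ℂ) : ℂ :=
  mellin (fun t : ℝ => Complex.exp (-A * t) * thetaRem d γ K t) s

theorem norm_remMellin_integrand_le {K : ℕ} {C : ℝ}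
    (hC : ∀ t : ℝ, 0 < t → ‖thetaRem d γ K t‖ ≤ C * t ^ K) (s A : ℂ) {t : ℝ} (ht : 0 < t) :
    ‖(t : ℂ) ^ (s - 1) * (Complex.exp (-A * t) * thetaRem d γ K t)‖
      ≤ C * (t ^ (s.re + K - 1) * Real.exp (-A.re * t)) := by
  rw [← mul_assoc, norm_mul, norm_cpow_mul_exp ht]
  have h1 : t ^ (s.re + K - 1) = t ^ (s.re - 1) * t ^ K := by
    rw [← Real.rpow_add_natCast ht.ne']; ring_nf
  rw [h1]
  have h4 : 0 < t ^ (s.re - 1) * Real.exp (-A.re * t) := by positivity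
  nlinarith [mul_le_mul_of_nonneg_left (hC t ht) h4.le]

theorem mellinConvergent_rem (hd : 0 < d) (hγ : 0 < γ.re) {K : ℕ} {s A : ℂ} (hs : -(K : ℝ) < s.re)
    (hA : 0 < A.re) :
    MellinConvergent (fun t : ℝ => Complex.exp (-A * t) * thetaRem d γ K t) s := by
  obtain ⟨C, -, hC⟩ := norm_thetaRem_le hd hγ K
  have h := (integrableOn_rpow_mul_exp (σ := s.re + K) (by linarith) hA).const_mul C
  refine h.mono' ?_ ?_
  · refine ContinuousOn.aestronglyMeasurable ?_ measurableSet_Ioi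
    simp only [smul_eq_mul, ← mul_assoc]
    exact (continuousOn_cpow_mul_exp s A).mul (continuousOn_thetaRem hd hγ K)
  · refine (ae_restrict_iff' measurableSet_Ioi).2 (Eventually.of_forall fun t ht => ?_)
    exact norm_remMellin_integrand_le hC s A ht

theorem norm_remMellin_le (hd : 0 < d) (hγ : 0 < γ.re) (K : ℕ) : ∃ C : ℝ, 0 ≤ C ∧
    ∀ s A : ℂ, -(K : ℝ) < s.re → 0 < A.re →
      ‖remMellin d γ K s A‖ ≤ C * Real.Gamma (s.re + K) * A.re ^ (-(s.re + K)) := by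
  obtain ⟨C, hC0, hC⟩ := norm_thetaRem_le hd hγ K
  refine ⟨C, hC0, fun s A hs hA => ?_⟩
  have hσ : 0 < s.re + K := by linarith
  have h := (integrableOn_rpow_mul_exp (σ := s.re + K) hσ hA).const_mul C
  refine (norm_integral_le_of_norm_le h ?_).trans_eq ?_
  · refine (ae_restrict_iff' measurableSet_Ioi).2 (Eventually.of_forall fun t ht => ?_)
    exact norm_remMellin_integrand_le hC s A ht
  · rw [integral_const_mul]
    have := Real.integral_rpow_mul_exp_neg_mul_Ioi hσ hA
    simp only [neg_mul]
    rw [this, one_div, Real.inv_rpow hA.le, Real.rpow_neg hA.le]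
    ring

theorem differentiableAt_remMellin (hd : 0 < d) (hγ : 0 < γ.re) {K : ℕ} {s A : ℂ}
    (hs : -(K : ℝ) < s.re) (hA : 0 < A.re) :
    DifferentiableAt ℂ (fun s => remMellin d γ K s A) s := by
  obtain ⟨C, hC0, hC⟩ := norm_thetaRem_le hd hγ K
  have hnorm : ∀ t : ℝ, 0 < t →
      ‖Complex.exp (-A * t) * thetaRem d γ K t‖ ≤ C * (t ^ K * Real.exp (-A.re * t)) := by
    intro t ht
    rw [norm_mul, Complex.norm_exp, Complex.re_mul_ofReal, Complex.neg_re]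
    nlinarith [mul_le_mul_of_nonneg_left (hC t ht) (Real.exp_pos (-A.re * t)).le]
  refine mellin_differentiableAt_of_isBigO_rpow_exp (half_pos hA) (b := -(K : ℝ)) ?_ ?_ ?_ hs
  · refine ContinuousOn.locallyIntegrableOn ?_ measurableSet_Ioi
    exact ContinuousOn.mul (by fun_prop) (continuousOn_thetaRem hd hγ K)
  · have h1 : (fun t : ℝ => Complex.exp (-A * t) * thetaRem d γ K t)
        =O[atTop] fun t : ℝ => t ^ K * Real.exp (-A.re * t) := by
      refine Asymptotics.IsBigO.of_bound C ?_
      filter_upwards [eventually_gt_atTop 0] with t ht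
      rw [Real.norm_of_nonneg (by positivity)]
      exact hnorm t ht
    refine h1.trans ?_
    refine ((isLittleO_pow_exp_pos_mul_atTop K (half_pos hA)).isBigO.mul
      (Asymptotics.isBigO_refl (fun t : ℝ => Real.exp (-A.re * t)) atTop)).congr_right fun t => ?_
    rw [← Real.exp_add]
    congr 1
    ring
  · refine Asymptotics.IsBigO.of_bound C ?_
    filter_upwards [self_mem_nhdsWithin] with t ht
    have ht' : 0 < t := ht
    rw [neg_neg, Real.rpow_natCast, Real.norm_of_nonneg (by positivity)]
    refine (hnorm t ht').trans (mul_le_mul_of_nonneg_left ?_ hC0)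
    have : Real.exp (-A.re * t) ≤ 1 := Real.exp_le_one_iff.2 (by nlinarith)
    nlinarith [pow_pos ht' K]

theorem mellin_pow_mul_exp {s A : ℂ} {i : ℕ} (hs : 0 < (s + i).re) (hA : 0 < A.re) (c : ℂ) :
    HasMellin (fun t : ℝ => Complex.exp (-A * t) * (c * (t : ℂ) ^ i)) s
      (c * (Complex.Gamma (s + i) * A ^ (-(s + i)))) := by
  have h : (fun t : ℝ => Complex.exp (-A * t) * (c * (t : ℂ) ^ i))
      = fun t : ℝ => c • ((t : ℂ) ^ (i : ℂ) • Complex.exp (-A * t)) := by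
    ext t
    rw [Complex.cpow_natCast, smul_eq_mul, smul_eq_mul]
    ring
  rw [h]
  refine ⟨(MellinConvergent.cpow_smul.2 (mellinConvergent_exp hs hA)).const_smul c, ?_⟩
  rw [mellin_const_smul, mellin_cpow_smul, mellin_exp hs hA, smul_eq_mul]

theorem mellin_rpow_mul_exp {s A : ℂ} {p : ℝ} (hs : 0 < (s + p).re) (hA : 0 < A.re) (c : ℂ) :
    HasMellin (fun t : ℝ => Complex.exp (-A * t) * (c * ((t ^ p : ℝ) : ℂ))) s
      (c * (Complex.Gamma (s + p) * A ^ (-(s + p)))) := by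
  have h : ∀ t ∈ Set.Ioi (0 : ℝ),
      (t : ℂ) ^ (s - 1) • (Complex.exp (-A * t) * (c * ((t ^ p : ℝ) : ℂ)))
      = (t : ℂ) ^ (s - 1) • (c • ((t : ℂ) ^ (p : ℂ) • Complex.exp (-A * t))) := by
    intro t ht
    rw [Complex.ofReal_cpow (le_of_lt ht)]
    simp only [smul_eq_mul]
    ring
  have h1 : MellinConvergent (fun t : ℝ => c • ((t : ℂ) ^ (p : ℂ) • Complex.exp (-A * t))) s :=
    (MellinConvergent.cpow_smul.2 (mellinConvergent_exp hs hA)).const_smul c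
  refine ⟨IntegrableOn.congr_fun h1 (fun t ht => (h t ht).symm) measurableSet_Ioi, ?_⟩
  rw [mellin, setIntegral_congr_fun measurableSet_Ioi h]
  change mellin (fun t : ℝ => c • ((t : ℂ) ^ (p : ℂ) • Complex.exp (-A * t))) s = _
  rw [mellin_const_smul, mellin_cpow_smul, mellin_exp hs hA, smul_eq_mul]

theorem remMellin_succ (hd : 0 < d) (hγ : 0 < γ.re) {K : ℕ} {s A : ℂ} (hs : -(K : ℝ) < s.re)
    (hA : 0 < A.re) :
    remMellin d γ K s A = remMellin d γ (K + 1) s A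
      + thetaCoeff d γ K * (Complex.Gamma (s + K) * A ^ (-(s + K))) := by
  have h1 := mellinConvergent_rem hd hγ (K := K + 1) (s := s) (A := A) (by push_cast; linarith) hA
  have h2 := mellin_pow_mul_exp (s := s) (i := K) (A := A) (by simp; linarith) hA (thetaCoeff d γ K)
  rw [← h2.2, remMellin, remMellin, ← (hasMellin_add h1 h2.1).2]
  congr 1
  ext t
  rw [thetaRem, thetaRem, Finset.sum_range_succ]
  ring

theorem hasSum_of_eq {ι : Type*} {f : ι → ℂ} {a b : ℂ} (h : HasSum f a) (e : a = b) :
    HasSum f b := e ▸ h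

/-- The sum over the last index is the Mellin transform of `exp(-A t) θ(t)`, up to `Γ(s)`. -/
theorem hasSum_cpow_mellin_theta (hd : 0 < d) (hγ : 0 < γ.re) {s A : ℂ} (hs : 1 / (d : ℝ) < s.re)
    (hA : 0 < A.re) :
    HasSum (fun m : ℕ+ => Complex.Gamma s * (A + γ * ((m : ℕ) : ℂ) ^ d) ^ (-s))
      (mellin (fun t : ℝ => Complex.exp (-A * t) * theta d γ t) s) := by
  have hs0 : 0 < s.re := lt_of_le_of_lt (by positivity) hs
  have hre : ∀ m : ℕ+, 0 < (A + γ * ((m : ℕ) : ℂ) ^ d).re := by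
    intro m
    have h1 : (γ * ((m : ℕ) : ℂ) ^ d).re = γ.re * ((m : ℕ) : ℝ) ^ d := by
      rw [← Complex.ofReal_natCast, ← Complex.ofReal_pow, Complex.re_mul_ofReal]
    rw [Complex.add_re, h1]
    have := m.pos
    positivity
  have hterm : ∀ m : ℕ+, ∀ t : ℝ, Complex.exp (-A * t) * Complex.exp (-γ * ((m : ℕ) : ℂ) ^ d * t)
      = Complex.exp (-(A + γ * ((m : ℕ) : ℂ) ^ d) * t) := by
    intro m t
    rw [← Complex.exp_add]
    congr 1
    ring
  have h := hasSum_integral_of_summable_integral_norm (μ := volume.restrict (Set.Ioi (0 : ℝ)))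
    (F := fun (m : ℕ+) (t : ℝ) => (t : ℂ) ^ (s - 1)
      * Complex.exp (-(A + γ * ((m : ℕ) : ℂ) ^ d) * t))
    (fun m => integrableOn_cpow_mul_exp hs0 (hre m)) ?_
  · have e1 : ∀ m : ℕ+, ∫ t in Set.Ioi (0 : ℝ), (t : ℂ) ^ (s - 1)
        * Complex.exp (-(A + γ * ((m : ℕ) : ℂ) ^ d) * t)
        = Complex.Gamma s * (A + γ * ((m : ℕ) : ℂ) ^ d) ^ (-s) := fun m => mellin_exp hs0 (hre m)
    simp only [e1] at h
    refine hasSum_of_eq h ?_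
    refine setIntegral_congr_fun measurableSet_Ioi fun t ht => ?_
    simp only [theta, smul_eq_mul]
    rw [tsum_mul_left, ← tsum_mul_left (a := Complex.exp (-A * t))]
    simp only [hterm]
  · have e2 : ∀ m : ℕ+, ∫ t in Set.Ioi (0 : ℝ), ‖(t : ℂ) ^ (s - 1)
        * Complex.exp (-(A + γ * ((m : ℕ) : ℂ) ^ d) * t)‖
        = Real.Gamma s.re * (A + γ * ((m : ℕ) : ℂ) ^ d).re ^ (-s.re) := by
      intro m
      rw [setIntegral_congr_fun measurableSet_Ioi (g := fun t : ℝ => t ^ (s.re - 1)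
        * Real.exp (-((A + γ * ((m : ℕ) : ℂ) ^ d).re * t)))
        (fun t ht => by simp only; rw [norm_cpow_mul_exp ht, neg_mul]),
        Real.integral_rpow_mul_exp_neg_mul_Ioi hs0 (hre m), one_div,
        Real.inv_rpow (hre m).le, Real.rpow_neg (hre m).le, mul_comm]
    simp only [e2]
    refine Summable.mul_left _ ?_
    have hd' : (0 : ℝ) < d := by exact_mod_cast hd
    have hsum : Summable fun m : ℕ+ => γ.re ^ (-s.re) * ((m : ℕ) : ℝ) ^ (-((d : ℝ) * s.re)) := by
      refine Summable.mul_left _ ?_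
      refine (Real.summable_nat_rpow.2 ?_).comp_injective PNat.coe_injective
      rw [div_lt_iff₀ hd'] at hs
      linarith
    refine Summable.of_nonneg_of_le (fun m => Real.rpow_nonneg (hre m).le _) (fun m => ?_) hsum
    have hm : (0 : ℝ) < (m : ℕ) := by exact_mod_cast m.pos
    have h1 : γ.re * ((m : ℕ) : ℝ) ^ d ≤ (A + γ * ((m : ℕ) : ℂ) ^ d).re := by
      rw [Complex.add_re, ← Complex.ofReal_natCast, ← Complex.ofReal_pow, Complex.re_mul_ofReal]
      linarith
    refine (Real.rpow_le_rpow_of_nonpos (by positivity) h1 (by linarith)).trans_eq ?_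
    rw [Real.mul_rpow hγ.le (by positivity), ← Real.rpow_natCast, ← Real.rpow_mul hm.le]
    ring_nf

/-- The inner sum of the multiple series, over the last index, split according to the expansion of
`theta`. -/
theorem hasSum_inner (hd : 0 < d) (hγ : 0 < γ.re) {s A : ℂ} (hs : 1 / (d : ℝ) < s.re)
    (hA : 0 < A.re) (K : ℕ) :
    HasSum (fun m : ℕ+ => (A + γ * ((m : ℕ) : ℂ) ^ d) ^ (-s))
      (thetaLead d γ * ((Complex.Gamma s)⁻¹ * Complex.Gamma (s - 1 / d)) * A ^ (-(s - 1 / d))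
        + ∑ i ∈ Finset.range K, thetaCoeff d γ i * (ascPochhammer ℂ i).eval s * A ^ (-(s + i))
        + (Complex.Gamma s)⁻¹ * remMellin d γ K s A) := by
  have hs0 : 0 < s.re := lt_of_le_of_lt (by positivity) hs
  have hΓ := Complex.Gamma_ne_zero_of_re_pos hs0
  have h := (hasSum_cpow_mellin_theta hd hγ hs hA).mul_left (Complex.Gamma s)⁻¹
  simp only [inv_mul_cancel_left₀ hΓ] at h
  refine hasSum_of_eq h ?_
  have h1 := mellin_rpow_mul_exp (s := s) (p := -(1 / (d : ℝ))) (A := A)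
    (by simp only [Complex.add_re, Complex.ofReal_re]; linarith) hA (thetaLead d γ)
  have h2 : ∀ K : ℕ, HasMellin (fun t : ℝ => ∑ i ∈ Finset.range K,
      Complex.exp (-A * t) * (thetaCoeff d γ i * (t : ℂ) ^ i)) s
      (∑ i ∈ Finset.range K, thetaCoeff d γ i * (Complex.Gamma (s + i) * A ^ (-(s + i)))) := by
    intro K
    induction K with
    | zero =>
      have : MellinConvergent (fun _ : ℝ => (0 : ℂ)) s := by simp [MellinConvergent]
      simpa [HasMellin, mellin] using this
    | succ K ih =>
      have h3 := mellin_pow_mul_exp (s := s) (i := K) (A := A)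
        (by simp only [Complex.add_re, Complex.natCast_re]; positivity) hA (thetaCoeff d γ K)
      have := hasMellin_add ih.1 h3.1
      simp only [Finset.sum_range_succ]
      rwa [ih.2, h3.2] at this
  have h4 := mellinConvergent_rem hd hγ (K := K) (s := s) (A := A)
    (by have := Nat.cast_nonneg (α := ℝ) K; linarith) hA
  have h5 := hasMellin_add (hasMellin_add h1.1 (h2 K).1).1 h4
  have h6 : mellin (fun t : ℝ => Complex.exp (-A * t) * theta d γ t) s
      = thetaLead d γ
          * (Complex.Gamma (s + (-(1 / (d : ℝ)) : ℝ)) * A ^ (-(s + (-(1 / (d : ℝ)) : ℝ))))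
        + ∑ i ∈ Finset.range K, thetaCoeff d γ i * (Complex.Gamma (s + i) * A ^ (-(s + i)))
        + remMellin d γ K s A := by
    have e := h5.2
    rw [(hasMellin_add h1.1 (h2 K).1).2, h1.2, (h2 K).2] at e
    rw [remMellin, ← e]
    congr 1
    ext t
    rw [thetaRem, ← Finset.mul_sum]
    ring
  have h7 : s + ((-(1 / (d : ℝ)) : ℝ) : ℂ) = s - 1 / d := by push_cast; ring
  rw [h6, h7, mul_add, mul_add, Finset.mul_sum]
  congr 2
  · ring
  · refine Finset.sum_congr rfl fun i _ => ?_
    rw [← inv_Gamma_mul_Gamma_add (s := s) (i := i)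
      (by simp only [Complex.add_re, Complex.natCast_re]; positivity)]
    ring

end

/-! ### Absolute convergence -/

section

/-- Removes the last variable, adding its value and a shift `c` to the variable before:
`(s₁, …, s_{n+1}, s_{n+2}) ↦ (s₁, …, s_n, s_{n+1} + s_{n+2} + c)`. -/
def merge {R : Type*} [AddCommMonoid R] {n : ℕ} (s : Fin (n + 2) → R) (c : R) : Fin (n + 1) → R :=
  fun i => s i.castSucc + if i = Fin.last n then s (Fin.last (n + 1)) + c else 0

theorem sum_Ici_castSucc {R : Type*} [AddCommMonoid R] {n : ℕ} (f : Fin (n + 1) → R) (j : Fin n) :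
    ∑ i ∈ Finset.Ici j.castSucc, f i
      = ∑ i ∈ Finset.Ici j, f i.castSucc + f (Fin.last n) := by
  rw [← Finset.filter_le_eq_Ici, ← Finset.filter_le_eq_Ici, Finset.sum_filter, Finset.sum_filter,
    Fin.sum_univ_castSucc]
  simp [Fin.le_last]

theorem sum_Ici_merge {R : Type*} [AddCommMonoid R] {n : ℕ} (s : Fin (n + 2) → R) (c : R)
    (j : Fin (n + 1)) :
    ∑ i ∈ Finset.Ici j, merge s c i = ∑ i ∈ Finset.Ici j.castSucc, s i + c := by
  rw [sum_Ici_castSucc]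
  simp only [merge, Finset.sum_add_distrib]
  rw [Finset.sum_ite_eq' (Finset.Ici j) (Fin.last n), if_pos (Finset.mem_Ici.2 (Fin.le_last j)),
    add_assoc]

theorem sum_Ici_last {R : Type*} [AddCommMonoid R] {n : ℕ} (f : Fin (n + 1) → R) :
    ∑ i ∈ Finset.Ici (Fin.last n), f i = f (Fin.last n) := by
  have : Finset.Ici (Fin.last n) = {Fin.last n} := by
    ext i; simp [Fin.last_le_iff]
  rw [this, Finset.sum_singleton]

section Forms

variable {n : ℕ} {d : Fin n → ℕ} {γ : Fin n → ℂ}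

theorem re_partialForm (d : Fin n → ℕ) (γ : Fin n → ℂ) (m : Fin n → ℕ+) (j : Fin n) :
    (partialForm d γ m j).re = ∑ i ∈ Finset.Iic j, (γ i).re * ((m i : ℕ) : ℝ) ^ d i := by
  rw [partialForm, Complex.re_sum]
  refine Finset.sum_congr rfl fun i _ => ?_
  rw [← Complex.ofReal_natCast, ← Complex.ofReal_pow, Complex.re_mul_ofReal]

theorem re_partialForm_pos (d : Fin n → ℕ) (hγ : ∀ j, 0 < (γ j).re) (m : Fin n → ℕ+) (j : Fin n) :
    0 < (partialForm d γ m j).re := by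
  rw [re_partialForm]
  refine Finset.sum_pos (fun i _ => ?_) ⟨j, Finset.mem_Iic.2 le_rfl⟩
  have := hγ i
  have := (m i).pos
  positivity

theorem partialForm_ne_zero (d : Fin n → ℕ) (hγ : ∀ j, 0 < (γ j).re) (m : Fin n → ℕ+) (j : Fin n) :
    partialForm d γ m j ≠ 0 := fun h => by
  have := re_partialForm_pos d hγ m j
  rw [h] at this
  exact lt_irrefl _ this

/-- The partial forms lie in a closed sector inside the right half plane, away from the origin. -/
theorem exists_sector (d : Fin n → ℕ) (hγ : ∀ j, 0 < (γ j).re) : ∃ C : ℝ, 1 ≤ C ∧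
    ∀ m j, ‖partialForm d γ m j‖ ≤ C * (partialForm d γ m j).re ∧
      1 ≤ C * (partialForm d γ m j).re := by
  obtain ⟨C₁, h₁⟩ := Finite.exists_le fun i => ‖γ i‖ / (γ i).re
  obtain ⟨C₂, h₂⟩ := Finite.exists_le fun i => 1 / (γ i).re
  refine ⟨max 1 (max C₁ C₂), le_max_left _ _, fun m j => ⟨?_, ?_⟩⟩
  · rw [re_partialForm, Finset.mul_sum, partialForm]
    refine norm_sum_le_of_le _ fun i _ => ?_
    rw [norm_mul, norm_pow, Complex.norm_natCast, ← mul_assoc]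
    refine mul_le_mul_of_nonneg_right ?_ (by positivity)
    rw [← div_le_iff₀ (hγ i)]
    exact (h₁ i).trans ((le_max_left _ _).trans (le_max_right _ _))
  · have h3 : (γ j).re ≤ (partialForm d γ m j).re := by
      rw [re_partialForm]
      refine le_trans ?_ (Finset.single_le_sum (f := fun i => (γ i).re * ((m i : ℕ) : ℝ) ^ d i)
        (fun i _ => ?_) (Finset.mem_Iic.2 (le_refl j)))
      · refine le_mul_of_one_le_right (hγ j).le (one_le_pow₀ ?_)
        exact_mod_cast _root_.one_le (a := m j)
      · have := hγ i
        positivity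
    have h4 : 1 / (γ j).re ≤ max 1 (max C₁ C₂) :=
      (h₂ j).trans ((le_max_right _ _).trans (le_max_right _ _))
    rw [div_le_iff₀ (hγ j)] at h4
    exact h4.trans (mul_le_mul_of_nonneg_left h3 (zero_le_one.trans (le_max_left _ _)))

/-- The modulus of the general term of the multiple series at a real point `τ`. -/
noncomputable def absTerm (d : Fin n → ℕ) (γ : Fin n → ℂ) (τ : Fin n → ℝ) (m : Fin n → ℕ+) : ℝ :=
  ∏ j, ‖partialForm d γ m j‖ ^ (-τ j)

/-- For `z` away from the origin, `|z^{-s}|` is bounded by `|z|^{-τ}`, uniformly for `s` in a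
rectangle with left edge at `τ`. -/
theorem norm_inv_cpow_le {C B : ℝ} (hC : 1 ≤ C) {z s : ℂ} {τ : ℝ} (hz : z ≠ 0)
    (hCz : 1 ≤ C * ‖z‖) (him : |s.im| ≤ B) (h1 : τ ≤ s.re) (h2 : s.re ≤ τ + B) :
    ‖(z ^ s)⁻¹‖ ≤ (Real.exp (Real.pi * B) * C ^ B) * ‖z‖ ^ (-τ) := by
  have hz0 : 0 < ‖z‖ := norm_pos_iff.2 hz
  have hC0 : 0 < C := by linarith
  rw [norm_inv, Complex.norm_cpow_of_ne_zero hz, inv_div, div_eq_mul_inv, ← Real.rpow_neg hz0.le,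
    mul_assoc]
  refine mul_le_mul ?_ ?_ (Real.rpow_nonneg hz0.le _) (Real.exp_pos _).le
  · rw [Real.exp_le_exp]
    refine (le_abs_self _).trans ?_
    rw [abs_mul]
    exact mul_le_mul (Complex.abs_arg_le_pi z) him (abs_nonneg _) Real.pi_pos.le
  · have e : -s.re = -(s.re - τ) + -τ := by ring
    rw [e, Real.rpow_add hz0]
    refine mul_le_mul_of_nonneg_right ?_ (Real.rpow_nonneg hz0.le _)
    have h3 : ‖z‖ ^ (-(s.re - τ)) ≤ C ^ (s.re - τ) := by
      rw [Real.rpow_neg hz0.le, ← Real.inv_rpow hz0.le]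
      refine Real.rpow_le_rpow (by positivity) ?_ (by linarith)
      rw [inv_le_iff_one_le_mul₀ hz0]
      exact hCz
    exact h3.trans (Real.rpow_le_rpow_of_exponent_le hC (by linarith))

/-- Near a point, the general term is dominated by the general term at a real point whose
coordinates are slightly smaller. -/
theorem norm_zetaTerm_le (d : Fin n → ℕ) (hγ : ∀ j, 0 < (γ j).re) (B : ℝ) : ∃ D : ℝ, 0 ≤ D ∧
    ∀ (s : Fin n → ℂ) (τ : Fin n → ℝ),
      (∀ j, |(s j).im| ≤ B ∧ τ j ≤ (s j).re ∧ (s j).re ≤ τ j + B) →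
      ∀ m, ‖zetaTerm d γ s m‖ ≤ D * absTerm d γ τ m := by
  obtain ⟨C, hC, hsec⟩ := exists_sector d hγ
  have hC0 : 0 < C := by linarith
  refine ⟨(Real.exp (Real.pi * B) * C ^ B) ^ n, by positivity, fun s τ h m => ?_⟩
  rw [zetaTerm, one_div, ← Finset.prod_inv_distrib, norm_prod, absTerm]
  have : (Real.exp (Real.pi * B) * C ^ B) ^ n * ∏ j, ‖partialForm d γ m j‖ ^ (-τ j)
      = ∏ j, (Real.exp (Real.pi * B) * C ^ B) * ‖partialForm d γ m j‖ ^ (-τ j) := by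
    rw [Finset.prod_mul_distrib, Finset.prod_const, Finset.card_univ, Fintype.card_fin]
  rw [this]
  refine Finset.prod_le_prod (fun j _ => norm_nonneg _) fun j _ => ?_
  refine norm_inv_cpow_le hC (partialForm_ne_zero d hγ m j) ((hsec m j).2.trans ?_)
    (h j).1 (h j).2.1 (h j).2.2
  exact mul_le_mul_of_nonneg_left (Complex.re_le_norm _) hC0.le

end Forms

section Step

variable {n : ℕ} {d : Fin (n + 2) → ℕ} {γ : Fin (n + 2) → ℂ}

theorem partialForm_snoc_castSucc {n : ℕ} (d : Fin (n + 1) → ℕ) (γ : Fin (n + 1) → ℂ)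
    (m : Fin n → ℕ+) (x : ℕ+) (j : Fin n) :
    partialForm d γ (Fin.snoc m x : Fin (n + 1) → ℕ+) j.castSucc
      = partialForm (Fin.init d) (Fin.init γ) m j := by
  rw [partialForm, partialForm, ← Finset.filter_ge_eq_Iic, ← Finset.filter_ge_eq_Iic,
    Finset.sum_filter, Finset.sum_filter, Fin.sum_univ_castSucc]
  have : ¬ Fin.last n ≤ j.castSucc := not_le.2 (Fin.castSucc_lt_last j)
  simp [Fin.init, this]

theorem partialForm_snoc_last (d : Fin (n + 2) → ℕ) (γ : Fin (n + 2) → ℂ)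
    (m : Fin (n + 1) → ℕ+) (x : ℕ+) :
    partialForm d γ (Fin.snoc m x : Fin (n + 2) → ℕ+) (Fin.last (n + 1))
      = partialForm (Fin.init d) (Fin.init γ) m (Fin.last n)
        + γ (Fin.last (n + 1)) * ((x : ℕ) : ℂ) ^ d (Fin.last (n + 1)) := by
  rw [partialForm, partialForm, ← Finset.filter_ge_eq_Iic, ← Finset.filter_ge_eq_Iic,
    Finset.sum_filter, Finset.sum_filter, Fin.sum_univ_castSucc]
  simp [Fin.init, Fin.le_last]

theorem prod_mul_last {M : Type*} [CommMonoid M] {n : ℕ} (f g : Fin (n + 1) → M) (x : M)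
    (hlast : g (Fin.last n) = f (Fin.last n) * x) (h : ∀ j : Fin n, g j.castSucc = f j.castSucc) :
    ∏ j, g j = (∏ j, f j) * x := by
  rw [Fin.prod_univ_castSucc, Fin.prod_univ_castSucc, hlast, mul_assoc]
  simp [h]

/-- Multiplying a term of depth `n + 1` by a power of the last partial form merges the exponents. -/
theorem zetaTerm_merge {d : Fin (n + 1) → ℕ} {γ : Fin (n + 1) → ℂ} (hγ : ∀ j, 0 < (γ j).re)
    (s : Fin (n + 2) → ℂ) (c : ℂ) (m : Fin (n + 1) → ℕ+) :
    zetaTerm d γ (merge s c) m = zetaTerm d γ (Fin.init s) m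
      * partialForm d γ m (Fin.last n) ^ (-(s (Fin.last (n + 1)) + c)) := by
  have hP := partialForm_ne_zero d hγ m (Fin.last n)
  simp only [zetaTerm, one_div, ← Finset.prod_inv_distrib]
  refine prod_mul_last _ _ _ ?_ fun j => ?_
  · simp only [merge, if_true, Fin.init]
    rw [Complex.cpow_add _ _ hP, mul_inv, Complex.cpow_neg]
  · simp [merge, Fin.init, (Fin.castSucc_lt_last j).ne]

theorem absTerm_merge {d : Fin (n + 1) → ℕ} {γ : Fin (n + 1) → ℂ} (hγ : ∀ j, 0 < (γ j).re)
    (τ : Fin (n + 2) → ℝ) (c : ℝ) (m : Fin (n + 1) → ℕ+) :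
    absTerm d γ (merge τ c) m = absTerm d γ (Fin.init τ) m
      * ‖partialForm d γ m (Fin.last n)‖ ^ (-(τ (Fin.last (n + 1)) + c)) := by
  have hP := norm_pos_iff.2 (partialForm_ne_zero d hγ m (Fin.last n))
  refine prod_mul_last _ _ _ ?_ fun j => ?_
  · simp only [merge, if_true, Fin.init]
    rw [neg_add, Real.rpow_add hP]
  · simp [merge, Fin.init, (Fin.castSucc_lt_last j).ne]

theorem zetaTerm_snoc (d : Fin (n + 2) → ℕ) (γ : Fin (n + 2) → ℂ) (s : Fin (n + 2) → ℂ)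
    (m : Fin (n + 1) → ℕ+) (x : ℕ+) :
    zetaTerm d γ s (Fin.snoc m x) = zetaTerm (Fin.init d) (Fin.init γ) (Fin.init s) m
      * (partialForm (Fin.init d) (Fin.init γ) m (Fin.last n)
        + γ (Fin.last (n + 1)) * ((x : ℕ) : ℂ) ^ d (Fin.last (n + 1)))
          ^ (-s (Fin.last (n + 1))) := by
  rw [zetaTerm, zetaTerm, Fin.prod_univ_castSucc, partialForm_snoc_last, Complex.cpow_neg, one_div,
    one_div, mul_inv]
  simp only [partialForm_snoc_castSucc, Fin.init]

theorem absTerm_snoc (d : Fin (n + 2) → ℕ) (γ : Fin (n + 2) → ℂ) (τ : Fin (n + 2) → ℝ)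
    (m : Fin (n + 1) → ℕ+) (x : ℕ+) :
    absTerm d γ τ (Fin.snoc m x) = absTerm (Fin.init d) (Fin.init γ) (Fin.init τ) m
      * ‖partialForm (Fin.init d) (Fin.init γ) m (Fin.last n)
        + γ (Fin.last (n + 1)) * ((x : ℕ) : ℂ) ^ d (Fin.last (n + 1))‖
          ^ (-τ (Fin.last (n + 1))) := by
  rw [absTerm, absTerm, Fin.prod_univ_castSucc, partialForm_snoc_last]
  simp only [partialForm_snoc_castSucc, Fin.init]

end Step

/-- A margin in the finitely many inequalities defining the domain of convergence. -/
theorem exists_margin {n : ℕ} {a b : Fin n → ℝ} (h : ∀ j, a j < b j) :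
    ∃ ε > 0, ∀ j, a j + ε < b j := by
  have h1 : ∀ᶠ ε : ℝ in 𝓝[>] 0, ∀ j, a j + ε < b j := by
    rw [eventually_all]
    intro j
    refine nhdsWithin_le_nhds ?_
    have : ContinuousAt (fun ε : ℝ => a j + ε) 0 := by fun_prop
    exact this.eventually_lt continuousAt_const (by simpa using h j)
  obtain ⟨ε, h2, h3⟩ := (h1.and self_mem_nhdsWithin).exists
  exact ⟨ε, h3, h2⟩

theorem absTerm_nonneg {n : ℕ} (d : Fin n → ℕ) (γ : Fin n → ℂ) (τ : Fin n → ℝ) (m : Fin n → ℕ+) :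
    0 ≤ absTerm d γ τ m :=
  Finset.prod_nonneg fun _ _ => Real.rpow_nonneg (norm_nonneg _) _

/-- Summability by induction on the depth. The last factor `|Q|^{-τ}` is split as
`|Q|^{-(τ - κ)} |Q|^{-κ}` with `κ` slightly larger than `1/d`: the first part is bounded in terms of
the last partial form of smaller depth, the second one in terms of `x^d`. -/
theorem summable_absTerm {n : ℕ} (d : Fin (n + 1) → ℕ) (hd : ∀ j, 0 < d j) (γ : Fin (n + 1) → ℂ)
    (hγ : ∀ j, 0 < (γ j).re) (τ : Fin (n + 1) → ℝ)
    (hτ : ∀ j, ∑ i ∈ Finset.Ici j, 1 / (d i : ℝ) < ∑ i ∈ Finset.Ici j, τ i) :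
    Summable (absTerm d γ τ) := by
  induction n with
  | zero =>
    have h0 : (0 : Fin 1) = Fin.last 0 := rfl
    have h := hτ 0
    rw [h0, sum_Ici_last, sum_Ici_last, ← h0] at h
    have hd' : (0 : ℝ) < d 0 := by exact_mod_cast hd 0
    rw [div_lt_iff₀ hd'] at h
    have h1 : Summable fun x : ℕ+ => ‖γ 0‖ ^ (-τ 0) * ((x : ℕ) : ℝ) ^ (-((d 0 : ℝ) * τ 0)) := by
      refine Summable.mul_left _ ?_
      refine (Real.summable_nat_rpow.2 ?_).comp_injective PNat.coe_injective
      linarith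
    refine (Equiv.funUnique (Fin 1) ℕ+).symm.summable_iff.1 (h1.congr fun x => ?_)
    have hP : partialForm d γ ((Equiv.funUnique (Fin 1) ℕ+).symm x) 0
        = γ 0 * ((x : ℕ) : ℂ) ^ d 0 := by
      rw [partialForm, show Finset.Iic (0 : Fin 1) = {0} from rfl, Finset.sum_singleton]
      rfl
    have hx : (0 : ℝ) < (x : ℕ) := by exact_mod_cast x.pos
    simp only [Function.comp_apply, absTerm]
    rw [Fin.prod_univ_one, hP, norm_mul, norm_pow, Complex.norm_natCast,
      Real.mul_rpow (norm_nonneg _) (by positivity), ← Real.rpow_natCast, ← Real.rpow_mul hx.le]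
    ring_nf
  | succ n ih =>
    set l := Fin.last (n + 1) with hl
    obtain ⟨ε, hε, hm⟩ := exists_margin hτ
    have hdl : (0 : ℝ) < d l := by exact_mod_cast hd l
    set κ : ℝ := 1 / (d l : ℝ) + ε with hκ
    have hκ0 : 0 < κ := by positivity
    have hlt : κ < τ l := by
      have := hm l
      rwa [sum_Ici_last, sum_Ici_last] at this
    obtain ⟨C, hC, hsec⟩ := exists_sector (Fin.init d) (γ := Fin.init γ) (fun j => hγ _)
    have hC0 : 0 < C := by linarith
    have h1 : Summable (absTerm (Fin.init d) (Fin.init γ) (merge τ (-κ))) := by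
      refine ih (Fin.init d) (fun j => hd _) (Fin.init γ) (fun j => hγ _) _ fun j => ?_
      have := hm j.castSucc
      rw [sum_Ici_castSucc] at this
      rw [sum_Ici_merge]
      simp only [Fin.init]
      linarith
    have h2 : Summable fun x : ℕ+ => ((x : ℕ) : ℝ) ^ (-((d l : ℝ) * κ)) := by
      refine (Real.summable_nat_rpow.2 ?_).comp_injective PNat.coe_injective
      rw [hκ, mul_add, mul_one_div_cancel hdl.ne']
      nlinarith
    have h3 := (h2.mul_of_nonneg h1 (fun x => by positivity)
      (fun m => absTerm_nonneg _ _ _ _)).mul_left (C ^ (τ l - κ) * (γ l).re ^ (-κ))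
    refine (Fin.snocEquiv fun _ => ℕ+).summable_iff.1 (Summable.of_nonneg_of_le
      (fun p => absTerm_nonneg _ _ _ _) (fun p => ?_) h3)
    obtain ⟨x, m⟩ := p
    have hx : (0 : ℝ) < (x : ℕ) := by exact_mod_cast x.pos
    change absTerm d γ τ (Fin.snoc m x) ≤ _
    set P := partialForm (Fin.init d) (Fin.init γ) m (Fin.last n) with hP
    have hPre : 0 < P.re := re_partialForm_pos (Fin.init d) (fun j => hγ _) m _
    have hP0 : 0 < ‖P‖ := hPre.trans_le (Complex.re_le_norm _)
    set Q := P + γ l * ((x : ℕ) : ℂ) ^ d l with hQ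
    have hγx : 0 < (γ l).re * ((x : ℕ) : ℝ) ^ d l := by
      have := hγ l
      positivity
    have hQre : Q.re = P.re + (γ l).re * ((x : ℕ) : ℝ) ^ d l := by
      rw [hQ, Complex.add_re, ← Complex.ofReal_natCast, ← Complex.ofReal_pow, Complex.re_mul_ofReal]
    have hQn := Complex.re_le_norm Q
    have hQ0 : 0 < ‖Q‖ := by linarith
    have hQP : C⁻¹ * ‖P‖ ≤ ‖Q‖ := by
      have h := (hsec m (Fin.last n)).1
      have : C⁻¹ * ‖P‖ ≤ P.re := by rwa [inv_mul_le_iff₀ hC0]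
      linarith
    rw [absTerm_snoc, absTerm_merge (γ := Fin.init γ) (fun j => hγ _)]
    have e1 : ‖Q‖ ^ (-τ l) = ‖Q‖ ^ (-(τ l - κ)) * ‖Q‖ ^ (-κ) := by
      rw [← Real.rpow_add hQ0]; ring_nf
    have e2 : ‖Q‖ ^ (-(τ l - κ)) ≤ C ^ (τ l - κ) * ‖P‖ ^ (-(τ l + -κ)) := by
      refine (Real.rpow_le_rpow_of_nonpos (by positivity) hQP (by linarith)).trans_eq ?_
      rw [Real.mul_rpow (by positivity) hP0.le, Real.inv_rpow hC0.le, Real.rpow_neg hC0.le, inv_inv,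
        sub_eq_add_neg]
    have e3 : ‖Q‖ ^ (-κ) ≤ (γ l).re ^ (-κ) * ((x : ℕ) : ℝ) ^ (-((d l : ℝ) * κ)) := by
      refine (Real.rpow_le_rpow_of_nonpos hγx (by linarith) (by linarith)).trans_eq ?_
      rw [Real.mul_rpow (hγ l).le (by positivity), ← Real.rpow_natCast, ← Real.rpow_mul hx.le]
      ring_nf
    have e4 := mul_le_mul e2 e3 (Real.rpow_nonneg hQ0.le _)
      (mul_nonneg (Real.rpow_nonneg hC0.le _) (Real.rpow_nonneg hP0.le _))
    calc absTerm (Fin.init d) (Fin.init γ) (Fin.init τ) m * ‖Q‖ ^ (-τ l)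
        ≤ absTerm (Fin.init d) (Fin.init γ) (Fin.init τ) m
          * (C ^ (τ l - κ) * ‖P‖ ^ (-(τ l + -κ))
            * ((γ l).re ^ (-κ) * ((x : ℕ) : ℝ) ^ (-((d l : ℝ) * κ)))) := by
          rw [e1]
          exact mul_le_mul_of_nonneg_left e4 (absTerm_nonneg _ _ _ _)
      _ = _ := by ring

theorem summable_zetaTerm {n : ℕ} {d : Fin (n + 1) → ℕ} (hd : ∀ j, 0 < d j) {γ : Fin (n + 1) → ℂ}
    (hγ : ∀ j, 0 < (γ j).re) {s : Fin (n + 1) → ℂ} (hs : s ∈ convDomain d) :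
    Summable (zetaTerm d γ s) := by
  obtain ⟨B, hB⟩ := Finite.exists_le fun j => |(s j).im|
  obtain ⟨D, -, hD⟩ := norm_zetaTerm_le d hγ B
  have hB0 : 0 ≤ B := (abs_nonneg _).trans (hB 0)
  have h1 := summable_absTerm d hd γ hγ (fun j => (s j).re) (fun j => by
    simpa [Complex.re_sum] using hs j)
  exact Summable.of_norm_bounded (h1.mul_left D)
    (hD s _ fun j => ⟨hB j, le_rfl, by linarith⟩)

end

/-! ### Meromorphic germs and the polar hyperplanes -/

section

/-- `F` is meromorphic at `a`: near `a` it is a quotient of holomorphic functions. -/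
def MeroAt {n : ℕ} (F : (Fin n → ℂ) → ℂ) (a : Fin n → ℂ) : Prop :=
  ∃ g h : (Fin n → ℂ) → ℂ, AnalyticAt ℂ g a ∧ AnalyticAt ℂ h a ∧ ¬ (∀ᶠ z in 𝓝 a, h z = 0) ∧
    ∀ᶠ z in 𝓝 a, h z ≠ 0 → F z = g z / h z

section Germs

variable {n : ℕ} {F G : (Fin n → ℂ) → ℂ} {a : Fin n → ℂ}

theorem _root_.AnalyticAt.meroAt (hF : AnalyticAt ℂ F a) : MeroAt F a :=
  ⟨F, 1, hF, analyticAt_const, fun H => one_ne_zero H.self_of_nhds,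
    Eventually.of_forall fun z _ => by simp⟩

theorem MeroAt.mul (hF : MeroAt F a) (hG : MeroAt G a) : MeroAt (fun z => F z * G z) a := by
  obtain ⟨g, h, hg, hh, h0, e⟩ := hF
  obtain ⟨g', h', hg', hh', h0', e'⟩ := hG
  refine ⟨g * g', h * h', hg.mul hg', hh.mul hh', mul_germ_ne_zero hh hh' h0 h0', ?_⟩
  filter_upwards [e, e'] with z hz hz' hne
  simp only [Pi.mul_apply, ne_eq, mul_eq_zero, not_or] at hne
  rw [hz hne.1, hz' hne.2, div_mul_div_comm]
  rfl

theorem MeroAt.add (hF : MeroAt F a) (hG : MeroAt G a) : MeroAt (fun z => F z + G z) a := by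
  obtain ⟨g, h, hg, hh, h0, e⟩ := hF
  obtain ⟨g', h', hg', hh', h0', e'⟩ := hG
  refine ⟨g * h' + h * g', h * h', (hg.mul hh').add (hh.mul hg'), hh.mul hh',
    mul_germ_ne_zero hh hh' h0 h0', ?_⟩
  filter_upwards [e, e'] with z hz hz' hne
  simp only [Pi.mul_apply, ne_eq, mul_eq_zero, not_or] at hne
  rw [hz hne.1, hz' hne.2, div_add_div _ _ hne.1 hne.2]
  rfl

theorem MeroAt.sum {ι : Type*} (t : Finset ι) {F : ι → (Fin n → ℂ) → ℂ}
    (h : ∀ i ∈ t, MeroAt (F i) a) : MeroAt (fun z => ∑ i ∈ t, F i z) a := by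
  classical
  induction t using Finset.induction_on with
  | empty => simpa using (analyticAt_const (v := (0 : ℂ))).meroAt
  | insert i t hi ih =>
    simp only [Finset.sum_insert hi]
    exact (h i (Finset.mem_insert_self _ _)).add
      (ih fun j hj => h j (Finset.mem_insert_of_mem hj))

theorem MeroAt.congr (hF : MeroAt F a) (h : F =ᶠ[𝓝 a] G) : MeroAt G a := by
  obtain ⟨g, k, hg, hk, k0, e⟩ := hF
  refine ⟨g, k, hg, hk, k0, ?_⟩
  filter_upwards [e, h] with z hz hz' hne
  rw [← hz', hz hne]

theorem analyticAt_coord (a : Fin n → ℂ) (j : Fin n) : AnalyticAt ℂ (fun s : Fin n → ℂ => s j) a :=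
  (ContinuousLinearMap.proj (R := ℂ) (φ := fun _ : Fin n => ℂ) j).analyticAt a

theorem _root_.AnalyticAt.comp_coord {f : ℂ → ℂ} {j : Fin n} (hf : AnalyticAt ℂ f (a j)) :
    AnalyticAt ℂ (fun s : Fin n → ℂ => f (s j)) a :=
  hf.comp (f := fun s : Fin n → ℂ => s j) (analyticAt_coord a j)

end Germs

section Merge

variable {n : ℕ}

theorem analyticAt_merge (c : ℂ) (a : Fin (n + 2) → ℂ) :
    AnalyticAt ℂ (fun s : Fin (n + 2) → ℂ => merge s c) a := by
  refine AnalyticAt.pi fun i => ?_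
  unfold merge
  refine (analyticAt_coord a _).add ?_
  split_ifs
  · exact (analyticAt_coord a _).add analyticAt_const
  · exact analyticAt_const

/-- A holomorphic germ that vanishes after composition with `merge` vanishes, since `merge` has
local sections. -/
theorem eventually_eq_zero_of_merge {h : (Fin (n + 1) → ℂ) → ℂ} {c : ℂ} {a : Fin (n + 2) → ℂ}
    (H : ∀ᶠ z in 𝓝 a, h (merge z c) = 0) : ∀ᶠ w in 𝓝 (merge a c), h w = 0 := by
  let σ : (Fin (n + 1) → ℂ) → (Fin (n + 2) → ℂ) := fun w =>
    Fin.snoc (fun j => a j.castSucc + (w j - merge a c j)) (a (Fin.last (n + 1)))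
  have h1 : σ (merge a c) = a := by
    ext j
    refine Fin.lastCases ?_ (fun j => ?_) j <;> simp [σ]
  have h2 : ∀ w, merge (σ w) c = w := by
    intro w
    ext j
    simp only [merge, σ, Fin.snoc_castSucc, Fin.snoc_last]
    ring
  have h3 : Continuous σ := by
    refine continuous_pi fun j => ?_
    refine Fin.lastCases ?_ (fun j => ?_) j
    · simp only [σ, Fin.snoc_last]; exact continuous_const
    · simp only [σ, Fin.snoc_castSucc]; fun_prop
  have h4 : Tendsto σ (𝓝 (merge a c)) (𝓝 a) := by
    have := h3.tendsto (merge a c)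
    rwa [h1] at this
  filter_upwards [h4.eventually H] with w hw
  rwa [h2] at hw

theorem MeroAt.comp_merge {F : (Fin (n + 1) → ℂ) → ℂ} {c : ℂ} {a : Fin (n + 2) → ℂ}
    (hF : MeroAt F (merge a c)) : MeroAt (fun s => F (merge s c)) a := by
  obtain ⟨g, h, hg, hh, h0, e⟩ := hF
  exact ⟨fun s => g (merge s c), fun s => h (merge s c), 
    hg.comp (f := fun s : Fin (n + 2) → ℂ => merge s c) (analyticAt_merge c a),
    hh.comp (f := fun s : Fin (n + 2) → ℂ => merge s c) (analyticAt_merge c a),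
    fun H => h0 (eventually_eq_zero_of_merge H),
    (analyticAt_merge c a).continuousAt.eventually e⟩

end Merge

section Gamma

variable {n : ℕ}

theorem analyticAt_inv_Gamma (s : ℂ) : AnalyticAt ℂ (fun s => (Complex.Gamma s)⁻¹) s :=
  Complex.differentiable_one_div_Gamma.analyticAt s

theorem meroAt_Gamma_coord (a : Fin (n + 1) → ℂ) (j : Fin (n + 1)) (c : ℂ) :
    MeroAt (fun s => Complex.Gamma (s j - c)) a := by
  have h1 : AnalyticAt ℂ (fun s : Fin (n + 1) → ℂ => (Complex.Gamma (s j - c))⁻¹) a :=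
    (analyticAt_inv_Gamma (a j - c)).comp (f := fun s : Fin (n + 1) → ℂ => s j - c)
      ((analyticAt_coord a j).sub analyticAt_const)
  refine ⟨fun _ => 1, _, analyticAt_const, h1, fun H => ?_, Eventually.of_forall fun z _ => by simp⟩
  -- `1 / Γ` has only isolated zeros on the line through `a` in the direction of the `j`-th axis
  have h2 : Tendsto (fun w : ℂ => Function.update a j w) (𝓝 (a j)) (𝓝 a) := by
    have : Continuous fun w : ℂ => Function.update a j w := continuous_const.update j continuous_id
    simpa using this.tendsto (a j)
  have h3 := h2.eventually H
  simp only [Function.update_self] at h3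
  have h4 : AnalyticOnNhd ℂ (fun w : ℂ => (Complex.Gamma (w - c))⁻¹) Set.univ := fun w _ =>
    (analyticAt_inv_Gamma (w - c)).comp (f := fun w : ℂ => w - c)
      (analyticAt_id.sub analyticAt_const)
  have h5 := congrFun
    (h4.eq_of_eventuallyEq (g := fun _ => 0) (fun _ _ => analyticAt_const) h3) (1 + c)
  simp at h5

theorem analyticAt_Gamma {s : ℂ} (hs : ∀ l : ℕ, s ≠ -l) : AnalyticAt ℂ Complex.Gamma s := by
  have := (analyticAt_inv_Gamma s).inv (inv_ne_zero (Complex.Gamma_ne_zero hs))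
  simpa [Pi.inv_def] using this

end Gamma

/-- The points off the possible polar hyperplanes
`sⱼ + ⋯ + sₙ + l = 1/dⱼ + ∑_{k > j} εₖ/dₖ` with `l ≥ 0` and `εₖ ∈ {0, 1}`. -/
def OffPoles {n : ℕ} (d : Fin n → ℕ) (s : Fin n → ℂ) : Prop :=
  ∀ (j : Fin n) (ε : Fin n → ℕ), (∀ k, ε k = 0 ∨ ε k = 1) → ∀ l : ℕ,
    ∑ i ∈ Finset.Ici j, s i + l ≠ 1 / (d j : ℂ) + ∑ k ∈ Finset.Ioi j, (ε k : ℂ) / (d k : ℂ)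

theorem sum_Ioi_castSucc {R : Type*} [AddCommMonoid R] {n : ℕ} (f : Fin (n + 1) → R) (j : Fin n) :
    ∑ i ∈ Finset.Ioi j.castSucc, f i
      = ∑ i ∈ Finset.Ioi j, f i.castSucc + f (Fin.last n) := by
  rw [← Finset.filter_lt_eq_Ioi, ← Finset.filter_lt_eq_Ioi, Finset.sum_filter, Finset.sum_filter,
    Fin.sum_univ_castSucc]
  simp [Fin.castSucc_lt_last]

section OffPoles

variable {n : ℕ} {d : Fin (n + 2) → ℕ} {s : Fin (n + 2) → ℂ}

/-- The shifts that occur in the continuation formula respect the polar hyperplanes: `e` plays the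
role of the last `ε`, and `i` is added to `l`. -/
theorem OffPoles.merge_shift (h : OffPoles d s) (e i : ℕ) (he : e = 0 ∨ e = 1) :
    OffPoles (Fin.init d) (merge s (i - e / d (Fin.last (n + 1)))) := by
  intro j ε hε l H
  refine h j.castSucc (Fin.snoc ε e : Fin (n + 2) → ℕ) (fun k => ?_) (i + l) ?_
  · refine Fin.lastCases ?_ (fun k => ?_) k
    · simpa using he
    · simpa using hε k
  · rw [sum_Ici_merge] at H
    rw [sum_Ioi_castSucc]
    simp only [Fin.snoc_castSucc, Fin.snoc_last]
    simp only [Fin.init] at H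
    push_cast
    linear_combination H

theorem OffPoles.merge_nat (h : OffPoles d s) (i : ℕ) : OffPoles (Fin.init d) (merge s i) := by
  simpa using h.merge_shift 0 i (Or.inl rfl)

theorem OffPoles.merge_inv (h : OffPoles d s) :
    OffPoles (Fin.init d) (merge s (-(1 / d (Fin.last (n + 1))))) := by
  simpa using h.merge_shift 1 0 (Or.inr rfl)

theorem OffPoles.last (h : OffPoles d s) (l : ℕ) :
    s (Fin.last (n + 1)) - 1 / d (Fin.last (n + 1)) ≠ -l := by
  intro H
  refine h (Fin.last (n + 1)) (fun _ => 0) (fun _ => Or.inl rfl) l ?_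
  rw [sum_Ici_last]
  simp only [Nat.cast_zero, zero_div, Finset.sum_const_zero, add_zero]
  linear_combination H

end OffPoles

/-- In depth one the multiple zeta function is `γ^{-s} ζ(ds)`. -/
theorem exists_continuation_one (d : Fin 1 → ℕ) (hd : ∀ j, 0 < d j) (γ : Fin 1 → ℂ)
    (hγ : ∀ j, 0 < (γ j).re) :
    ∃ F, IsContinuation d γ F ∧ ∀ s, OffPoles d s → AnalyticAt ℂ F s := by
  have hd0 : (d 0 : ℂ) ≠ 0 := by exact_mod_cast (hd 0).ne'
  have hγ0 : γ 0 ≠ 0 := fun h => by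
    have := hγ 0
    rw [h] at this
    exact lt_irrefl _ this
  have h0 : (0 : Fin 1) = Fin.last 0 := rfl
  have hpow : ∀ a : Fin 1 → ℂ, AnalyticAt ℂ (fun s : Fin 1 → ℂ => γ 0 ^ (-s 0)) a := by
    intro a
    have : Differentiable ℂ fun w : ℂ => γ 0 ^ (-w) := fun w =>
      (differentiableAt_id.neg).const_cpow (Or.inl hγ0)
    exact (this.analyticAt (a 0)).comp_coord
  have hlin : ∀ a : Fin 1 → ℂ, AnalyticAt ℂ (fun s : Fin 1 → ℂ => (d 0 : ℂ) * s 0) a :=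
    fun a => analyticAt_const.mul (analyticAt_coord a 0)
  refine ⟨fun s => γ 0 ^ (-s 0) * riemannZeta (d 0 * s 0), ⟨?_, ?_⟩, ?_⟩
  · intro a
    refine (hpow a).meroAt.mul ?_
    -- the entire function `(w - 1) ζ(w)`
    let Z : ℂ → ℂ := Function.update (fun w => (w - 1) * riemannZeta w) 1 1
    have hZ : ∀ w, AnalyticAt ℂ Z w := by
      have hne : ∀ w ≠ 1, DifferentiableAt ℂ Z w := by
        intro w hw
        have h1 : DifferentiableAt ℂ (fun w => (w - 1) * riemannZeta w) w :=
          (differentiableAt_id.sub_const 1).mul (differentiableAt_riemannZeta hw)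
        refine h1.congr_of_eventuallyEq ?_
        filter_upwards [isOpen_ne.mem_nhds hw] with z hz
        exact Function.update_of_ne hz _ _
      intro w
      rcases eq_or_ne w 1 with rfl | hw
      · refine Complex.analyticAt_of_differentiable_on_punctured_nhds_of_continuousAt ?_ ?_
        · filter_upwards [self_mem_nhdsWithin] with z hz using hne z hz
        · rw [continuousAt_update_same]
          exact riemannZeta_residue_one
      · refine (Complex.analyticAt_iff_eventually_differentiableAt).2 ?_
        filter_upwards [isOpen_ne.mem_nhds hw] with z hz using hne z hz
    refine ⟨fun s => Z (d 0 * s 0), fun s => d 0 * s 0 - 1,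
      (hZ _).comp (f := fun s : Fin 1 → ℂ => (d 0 : ℂ) * s 0) (hlin a),
      (hlin a).sub analyticAt_const, fun H => ?_, Eventually.of_forall fun z hz => ?_⟩
    · have h2 : Tendsto (fun w : ℂ => (fun _ => w : Fin 1 → ℂ)) (𝓝 (a 0)) (𝓝 a) := by
        have h3 : Continuous fun w : ℂ => (fun _ => w : Fin 1 → ℂ) := by fun_prop
        have h4 : (fun _ => a 0 : Fin 1 → ℂ) = a := by
          ext j; rw [Subsingleton.elim j 0]
        simpa [h4] using h3.tendsto (a 0)
      have h3 := h2.eventually H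
      have h5 := ((hasDerivAt_id (a 0)).const_mul (d 0 : ℂ)).sub_const 1
      have h6 := h5.unique ((hasDerivAt_const (a 0) (0 : ℂ)).congr_of_eventuallyEq h3)
      simp [hd0] at h6
    · have hz' : (d 0 : ℂ) * z 0 ≠ 1 := fun h => hz (by simp [h])
      simp only [Z, Function.update_of_ne hz']
      rw [mul_div_cancel_left₀ _ hz]
  · intro s hs
    have h := hs 0
    rw [h0, sum_Ici_last, sum_Ici_last, ← h0] at h
    have hdr : (0 : ℝ) < d 0 := by exact_mod_cast hd 0
    rw [div_lt_iff₀ hdr] at h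
    have hre : 1 < ((d 0 : ℂ) * s 0).re := by
      rw [← Complex.ofReal_natCast, Complex.re_ofReal_mul]
      linarith
    have hsum : HasSum (fun x : ℕ+ => 1 / ((x : ℕ) : ℂ) ^ ((d 0 : ℂ) * s 0))
        (riemannZeta (d 0 * s 0)) := by
      have hS : Summable fun x : ℕ+ => 1 / ((x : ℕ) : ℂ) ^ ((d 0 : ℂ) * s 0) :=
        (Complex.summable_one_div_nat_cpow.2 hre).comp_injective PNat.coe_injective
      have e : ∑' x : ℕ+, 1 / ((x : ℕ) : ℂ) ^ ((d 0 : ℂ) * s 0) = riemannZeta (d 0 * s 0) := by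
        rw [zeta_eq_tsum_one_div_nat_add_one_cpow hre,
          tsum_pnat_eq_tsum_succ (f := fun x : ℕ => 1 / (x : ℂ) ^ ((d 0 : ℂ) * s 0))]
        push_cast
        rfl
      exact hasSum_of_eq hS.hasSum e
    refine (Equiv.funUnique (Fin 1) ℕ+).symm.hasSum_iff.1 ?_
    have hterm : zetaTerm d γ s ∘ (Equiv.funUnique (Fin 1) ℕ+).symm
        = fun x : ℕ+ => γ 0 ^ (-s 0) * (1 / ((x : ℕ) : ℂ) ^ ((d 0 : ℂ) * s 0)) := by
      ext x
      have hP : partialForm d γ ((Equiv.funUnique (Fin 1) ℕ+).symm x) 0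
          = γ 0 * ((((x : ℕ) : ℝ) ^ d 0 : ℝ) : ℂ) := by
        rw [partialForm, show Finset.Iic (0 : Fin 1) = {0} from rfl, Finset.sum_singleton]
        push_cast
        rfl
      have hx : (0 : ℝ) < ((x : ℕ) : ℝ) ^ d 0 := by
        have := x.pos
        positivity
      have hx' : ((((x : ℕ) : ℝ) ^ d 0 : ℝ) : ℂ) ≠ 0 := by exact_mod_cast hx.ne'
      simp only [Function.comp_apply, zetaTerm]
      rw [Fin.prod_univ_one, hP, Complex.cpow_def_of_ne_zero (mul_ne_zero hγ0 hx'),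
        Complex.log_mul_ofReal _ hx _ hγ0, Complex.ofReal_log hx.le, add_mul, Complex.exp_add,
        ← Complex.cpow_def_of_ne_zero hx', ← Complex.cpow_def_of_ne_zero hγ0, Complex.cpow_neg,
        Complex.ofReal_pow, Complex.ofReal_natCast, Complex.natCast_cpow_natCast_mul]
      simp only [one_div, mul_inv]
      ring
    rw [hterm]
    exact hsum.mul_left _
  · intro s hs
    have h := hs 0 (fun _ => 0) (fun _ => Or.inl rfl) 0
    rw [h0, sum_Ici_last, ← h0] at h
    simp only [Nat.cast_zero, zero_div, Finset.sum_const_zero, add_zero] at h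
    have h1 : (d 0 : ℂ) * s 0 ≠ 1 := fun h2 => h (by rw [← h2]; field_simp)
    have h2 : AnalyticAt ℂ riemannZeta ((d 0 : ℂ) * s 0) := by
      refine (Complex.analyticAt_iff_eventually_differentiableAt).2 ?_
      filter_upwards [isOpen_ne.mem_nhds h1] with z hz using differentiableAt_riemannZeta hz
    exact (hpow s).mul (h2.comp (f := fun s : Fin 1 → ℂ => (d 0 : ℂ) * s 0) (hlin s))

end

/-! ### The remainder series and the continuation -/

section

open Metric

section Remainder

variable {n : ℕ} {d : Fin (n + 2) → ℕ} {γ : Fin (n + 2) → ℂ}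

/-- The region in which the remainder series of order `K` converges: its terms are of the size of
those of the series of smaller depth at `merge s K`. -/
def remDomain (d : Fin (n + 2) → ℕ) (K : ℕ) : Set (Fin (n + 2) → ℂ) :=
  {s | -(K : ℝ) < (s (Fin.last (n + 1))).re ∧ merge s (K : ℂ) ∈ convDomain (Fin.init d)}

/-- The general term of the remainder series of order `K`, without the factor `1 / Γ` of the last
variable. -/
noncomputable def remTerm (d : Fin (n + 2) → ℕ) (γ : Fin (n + 2) → ℂ) (K : ℕ)
    (m : Fin (n + 1) → ℕ+) (s : Fin (n + 2) → ℂ) : ℂ :=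
  zetaTerm (Fin.init d) (Fin.init γ) (Fin.init s) m
    * remMellin (d (Fin.last (n + 1))) (γ (Fin.last (n + 1))) K (s (Fin.last (n + 1)))
      (partialForm (Fin.init d) (Fin.init γ) m (Fin.last n))

/-- The remainder series of order `K`. -/
noncomputable def remSum (d : Fin (n + 2) → ℕ) (γ : Fin (n + 2) → ℂ) (K : ℕ)
    (s : Fin (n + 2) → ℂ) : ℂ :=
  ∑' m, remTerm d γ K m s

theorem re_sum_merge (s : Fin (n + 2) → ℂ) (c : ℂ) (j : Fin (n + 1)) :
    (∑ i ∈ Finset.Ici j, merge s c i).re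
      = ∑ i ∈ Finset.Ici j.castSucc, (s i).re + c.re := by
  rw [sum_Ici_merge, Complex.add_re, Complex.re_sum]

theorem isOpen_remDomain (d : Fin (n + 2) → ℕ) (K : ℕ) : IsOpen (remDomain d K) := by
  have h : remDomain d K = {s | -(K : ℝ) < (s (Fin.last (n + 1))).re} ∩
      ⋂ j : Fin (n + 1), {s | ∑ i ∈ Finset.Ici j, 1 / (Fin.init d i : ℝ)
        < ∑ i ∈ Finset.Ici j.castSucc, (s i).re + K} := by
    ext s
    rw [Set.mem_inter_iff, Set.mem_iInter]
    refine and_congr Iff.rfl (forall_congr' fun j => ?_)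
    rw [re_sum_merge, Complex.natCast_re]
    rfl
  rw [h]
  refine (isOpen_lt continuous_const (by fun_prop)).inter ?_
  exact isOpen_iInter_of_finite fun j => isOpen_lt continuous_const (by fun_prop)

theorem remDomain_mono (d : Fin (n + 2) → ℕ) {K K' : ℕ} (h : K ≤ K') :
    remDomain d K ⊆ remDomain d K' := by
  intro s hs
  have h' : (K : ℝ) ≤ K' := by exact_mod_cast h
  refine ⟨by linarith [hs.1], fun j => ?_⟩
  have := hs.2 j
  rw [re_sum_merge, Complex.natCast_re] at this ⊢
  linarith

theorem exists_mem_remDomain (d : Fin (n + 2) → ℕ) (s : Fin (n + 2) → ℂ) (M : ℕ) :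
    ∃ K, M ≤ K ∧ s ∈ remDomain d K := by
  obtain ⟨B, hB⟩ := Finite.exists_le fun j : Fin (n + 1) =>
    ∑ i ∈ Finset.Ici j, 1 / (Fin.init d i : ℝ) - ∑ i ∈ Finset.Ici j.castSucc, (s i).re
  obtain ⟨K, hK⟩ := exists_nat_gt (max (max B (-(s (Fin.last (n + 1))).re)) M)
  simp only [max_lt_iff] at hK
  refine ⟨K, by exact_mod_cast hK.2.le, by linarith [hK.1.2], fun j => ?_⟩
  rw [re_sum_merge, Complex.natCast_re]
  linarith [hB j, hK.1.1]

/-- The remainder series is dominated by a convergent series, locally uniformly. -/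
theorem exists_remTerm_bound (hd : ∀ j, 0 < d j) (hγ : ∀ j, 0 < (γ j).re) {K : ℕ}
    {a : Fin (n + 2) → ℂ} (ha : a ∈ remDomain d K) :
    ∃ r > 0, ∃ u : (Fin (n + 1) → ℕ+) → ℝ, Summable u ∧
      (∀ s ∈ closedBall a r, -(K : ℝ) < (s (Fin.last (n + 1))).re) ∧
      ∀ m, ∀ s ∈ closedBall a r, ‖remTerm d γ K m s‖ ≤ u m := by
  set l := Fin.last (n + 1) with hl
  -- a radius for which the lower corner of the polydisc stays in the domain
  have hev : ∀ᶠ r : ℝ in 𝓝[>] 0, -(K : ℝ) < (a l).re - r ∧ ∀ j : Fin (n + 1),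
      ∑ i ∈ Finset.Ici j, 1 / (Fin.init d i : ℝ)
        < ∑ i ∈ Finset.Ici j.castSucc, ((a i).re - r) + K := by
    refine nhdsWithin_le_nhds (Filter.Eventually.and ?_ (eventually_all.2 fun j => ?_))
    · have : ContinuousAt (fun r : ℝ => (a l).re - r) 0 := by fun_prop
      exact continuousAt_const.eventually_lt this (by simpa using ha.1)
    · have : ContinuousAt (fun r : ℝ => ∑ i ∈ Finset.Ici j.castSucc, ((a i).re - r) + K) 0 := by
        fun_prop
      refine continuousAt_const.eventually_lt this ?_
      have h := ha.2 j
      rw [re_sum_merge, Complex.natCast_re] at h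
      simpa using h
  obtain ⟨r, ⟨hr1, hr2⟩, hr0⟩ := (hev.and self_mem_nhdsWithin).exists
  have hr0' : 0 < r := hr0
  obtain ⟨B₀, hB₀⟩ := Finite.exists_le fun j => |(a j).im|
  have hB₀0 : 0 ≤ B₀ := (abs_nonneg _).trans (hB₀ l)
  set B := B₀ + 2 * r with hB
  set τ : Fin (n + 2) → ℝ := fun j => (a j).re - r with hτ
  have hs : ∀ s ∈ closedBall a r, ∀ j, |(s j).im| ≤ B ∧ τ j ≤ (s j).re ∧ (s j).re ≤ τ j + B := by
    intro s hs j
    have h1 : ‖s j - a j‖ ≤ r := by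
      rw [← dist_eq_norm]
      exact (dist_le_pi_dist s a j).trans hs
    have h2 := abs_le.1 ((Complex.abs_re_le_norm _).trans h1)
    have h3 := abs_le.1 ((Complex.abs_im_le_norm _).trans h1)
    have h4 := abs_le.1 (hB₀ j)
    rw [Complex.sub_re] at h2
    rw [Complex.sub_im] at h3
    simp only [hτ, hB]
    refine ⟨abs_le.2 ⟨by linarith, by linarith⟩, by linarith, by linarith⟩
  obtain ⟨D, hD0, hD⟩ := norm_zetaTerm_le (Fin.init d) (γ := Fin.init γ) (fun j => hγ _) B
  obtain ⟨E, hE0, hE⟩ := norm_remMellin_le (hd l) (hγ l) K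
  obtain ⟨C, hC, hsec⟩ := exists_sector (Fin.init d) (γ := Fin.init γ) (fun j => hγ _)
  have hC0 : 0 < C := by linarith
  have hτK : 0 < τ l + K := by simp only [hτ]; linarith
  obtain ⟨G, hG⟩ :=
    (isCompact_Icc (a := τ l + (K : ℝ)) (b := τ l + B + K)).exists_bound_of_continuousOn
    (f := Real.Gamma) fun x hx =>
      (Real.differentiableAt_Gamma fun k hk => by
        linarith [hτK.trans_le hx.1, (Nat.cast_nonneg k : (0 : ℝ) ≤ k)]
        ).continuousAt.continuousWithinAt
  have hG0 : 0 ≤ G := (norm_nonneg _).trans (hG (τ l + K) ⟨le_rfl, by linarith⟩)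
  have hsum := summable_absTerm (Fin.init d) (fun j => hd _) (Fin.init γ) (fun j => hγ _)
    (merge τ K) (fun j => by rw [sum_Ici_merge]; exact hr2 j)
  refine ⟨r, hr0', _, hsum.mul_left (D * (E * G * C ^ (τ l + B + K))), fun s h => ?_,
    fun m s h => ?_⟩
  · have := (hs s h l).2.1
    simp only [hτ] at this
    linarith
  · set P := partialForm (Fin.init d) (Fin.init γ) m (Fin.last n) with hP
    have hPre : 0 < P.re := re_partialForm_pos (Fin.init d) (fun j => hγ _) m _
    have hP0 : 0 < ‖P‖ := hPre.trans_le (Complex.re_le_norm _)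
    obtain ⟨-, h2, h3⟩ := hs s h l
    have hσ : 0 < (s l).re + K := by linarith
    have e1 := hD (Fin.init s) (Fin.init τ) (fun j => hs s h j.castSucc) m
    have e2 := hE (s l) P (by linarith) hPre
    have e3 : Real.Gamma ((s l).re + K) ≤ G :=
      (le_abs_self _).trans (hG _ ⟨by linarith, by linarith⟩)
    have e4 : P.re ^ (-((s l).re + K)) ≤ C ^ (τ l + B + K) * ‖P‖ ^ (-(τ l + K)) := by
      have f1 : P.re ^ (-((s l).re + K))
          = C ^ ((s l).re + K) * (C * P.re) ^ (-((s l).re + K)) := by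
        rw [Real.mul_rpow hC0.le hPre.le, ← mul_assoc, ← Real.rpow_add hC0]
        simp
      rw [f1]
      refine mul_le_mul (Real.rpow_le_rpow_of_exponent_le hC (by linarith)) ?_
        (Real.rpow_nonneg (by positivity) _) (Real.rpow_nonneg hC0.le _)
      refine (Real.rpow_le_rpow_of_exponent_le (hsec m (Fin.last n)).2
        (by linarith : -((s l).re + K) ≤ -(τ l + K))).trans ?_
      exact Real.rpow_le_rpow_of_nonpos hP0 (hsec m (Fin.last n)).1 (by linarith)
    have e5 : ‖remMellin (d l) (γ l) K (s l) P‖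
        ≤ E * G * (C ^ (τ l + B + K) * ‖P‖ ^ (-(τ l + K))) := by
      refine e2.trans (mul_le_mul (mul_le_mul_of_nonneg_left e3 hE0) e4
        (Real.rpow_nonneg hPre.le _) (mul_nonneg hE0 hG0))
    have e6 := mul_le_mul e1 e5 (norm_nonneg _) (mul_nonneg hD0 (absTerm_nonneg _ _ _ _))
    rw [remTerm, norm_mul]
    refine e6.trans_eq ?_
    rw [absTerm_merge (γ := Fin.init γ) (fun j => hγ _)]
    ring

theorem analyticAt_zetaTerm {n : ℕ} {d : Fin n → ℕ} {γ : Fin n → ℂ} (hγ : ∀ j, 0 < (γ j).re)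
    (m : Fin n → ℕ+) (s : Fin n → ℂ) : AnalyticAt ℂ (fun s => zetaTerm d γ s m) s := by
  have hP := partialForm_ne_zero d hγ m
  unfold zetaTerm
  refine analyticAt_const.div (Finset.analyticAt_fun_prod _ fun j _ => ?_)
    (Finset.prod_ne_zero_iff.2 fun j _ => by simp [Complex.cpow_eq_zero_iff, hP j])
  have : Differentiable ℂ fun w : ℂ => partialForm d γ m j ^ w := fun w =>
    differentiableAt_id.const_cpow (Or.inl (hP j))
  exact (this.analyticAt _).comp_coord

theorem analyticAt_remTerm (hd : ∀ j, 0 < d j) (hγ : ∀ j, 0 < (γ j).re) {K : ℕ}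
    (m : Fin (n + 1) → ℕ+) {s : Fin (n + 2) → ℂ} (hs : -(K : ℝ) < (s (Fin.last (n + 1))).re) :
    AnalyticAt ℂ (remTerm d γ K m) s := by
  have h1 : AnalyticAt ℂ (fun s : Fin (n + 2) → ℂ => (Fin.init s : Fin (n + 1) → ℂ)) s :=
    AnalyticAt.pi fun j => analyticAt_coord s j.castSucc
  have h2 : AnalyticAt ℂ (fun s : Fin (n + 2) → ℂ =>
      zetaTerm (Fin.init d) (Fin.init γ) (Fin.init s) m) s :=
    (analyticAt_zetaTerm (d := Fin.init d) (γ := Fin.init γ) (fun j => hγ _) m _).comp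
      (f := fun s : Fin (n + 2) → ℂ => (Fin.init s : Fin (n + 1) → ℂ)) h1
  have hPre : 0 < (partialForm (Fin.init d) (Fin.init γ) m (Fin.last n)).re :=
    re_partialForm_pos (Fin.init d) (fun j => hγ _) m _
  have h3 : AnalyticAt ℂ (fun w => remMellin (d (Fin.last (n + 1))) (γ (Fin.last (n + 1))) K w
      (partialForm (Fin.init d) (Fin.init γ) m (Fin.last n))) (s (Fin.last (n + 1))) := by
    refine Complex.analyticAt_iff_eventually_differentiableAt.2 ?_
    have : IsOpen {w : ℂ | -(K : ℝ) < w.re} := isOpen_lt continuous_const Complex.continuous_re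
    filter_upwards [this.mem_nhds hs] with w hw
    exact differentiableAt_remMellin (hd _) (hγ _) hw hPre
  exact h2.mul h3.comp_coord

theorem analyticAt_remSum (hd : ∀ j, 0 < d j) (hγ : ∀ j, 0 < (γ j).re) {K : ℕ}
    {a : Fin (n + 2) → ℂ} (ha : a ∈ remDomain d K) : AnalyticAt ℂ (remSum d γ K) a := by
  obtain ⟨r, hr, u, hu, hre, hle⟩ := exists_remTerm_bound hd hγ ha
  exact analyticAt_tsum hr hu (fun m s hs => analyticAt_remTerm hd hγ m (hre s hs)) hle

theorem hasSum_remSum (hd : ∀ j, 0 < d j) (hγ : ∀ j, 0 < (γ j).re) {K : ℕ}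
    {s : Fin (n + 2) → ℂ} (hs : s ∈ remDomain d K) :
    HasSum (fun m => remTerm d γ K m s) (remSum d γ K s) := by
  obtain ⟨r, hr, u, hu, -, hle⟩ := exists_remTerm_bound hd hγ hs
  exact (Summable.of_norm_bounded hu fun m => hle m s (mem_closedBall_self hr.le)).hasSum

/-- Since `merge s K` lies in the domain of absolute convergence, the difference of two consecutive
remainders is a value of the series itself. -/
theorem remSum_succ (hd : ∀ j, 0 < d j) (hγ : ∀ j, 0 < (γ j).re) {F : (Fin (n + 1) → ℂ) → ℂ}
    (hF : ∀ s ∈ convDomain (Fin.init d), HasSum (zetaTerm (Fin.init d) (Fin.init γ) s) (F s))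
    {K : ℕ} {s : Fin (n + 2) → ℂ} (hs : s ∈ remDomain d K) :
    remSum d γ K s = remSum d γ (K + 1) s
      + thetaCoeff (d (Fin.last (n + 1))) (γ (Fin.last (n + 1))) K
        * Complex.Gamma (s (Fin.last (n + 1)) + K) * F (merge s K) := by
  have h1 := hasSum_remSum hd hγ (remDomain_mono d (Nat.le_succ K) hs)
  have h2 := (hF _ hs.2).mul_left (thetaCoeff (d (Fin.last (n + 1))) (γ (Fin.last (n + 1))) K
    * Complex.Gamma (s (Fin.last (n + 1)) + K))
  refine (hasSum_remSum hd hγ hs).unique ?_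
  have h3 := h1.add h2
  refine h3.congr_fun fun m => ?_
  have hPre : 0 < (partialForm (Fin.init d) (Fin.init γ) m (Fin.last n)).re :=
    re_partialForm_pos (Fin.init d) (fun j => hγ _) m _
  rw [remTerm, remTerm, remMellin_succ (hd _) (hγ _) hs.1 hPre,
    zetaTerm_merge (γ := Fin.init γ) (fun j => hγ _)]
  ring

end Remainder

section Continuation

variable {n : ℕ} {d : Fin (n + 2) → ℕ} {γ : Fin (n + 2) → ℂ} {F : (Fin (n + 1) → ℂ) → ℂ}

/-- The continuation of the multiple zeta function to `remDomain d K`, in terms of a continuation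
`F` of the multiple zeta function of smaller depth. -/
noncomputable def contAux (d : Fin (n + 2) → ℕ) (γ : Fin (n + 2) → ℂ) (F : (Fin (n + 1) → ℂ) → ℂ)
    (K : ℕ) (s : Fin (n + 2) → ℂ) : ℂ :=
  thetaLead (d (Fin.last (n + 1))) (γ (Fin.last (n + 1)))
      * ((Complex.Gamma (s (Fin.last (n + 1))))⁻¹
        * Complex.Gamma (s (Fin.last (n + 1)) - 1 / d (Fin.last (n + 1))))
      * F (merge s (-(1 / d (Fin.last (n + 1)))))
    + ∑ i ∈ Finset.range K, thetaCoeff (d (Fin.last (n + 1))) (γ (Fin.last (n + 1))) i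
      * (ascPochhammer ℂ i).eval (s (Fin.last (n + 1))) * F (merge s i)
    + (Complex.Gamma (s (Fin.last (n + 1))))⁻¹ * remSum d γ K s

theorem contAux_eq_of_le (hd : ∀ j, 0 < d j) (hγ : ∀ j, 0 < (γ j).re)
    (hF : ∀ s ∈ convDomain (Fin.init d), HasSum (zetaTerm (Fin.init d) (Fin.init γ) s) (F s))
    {K K' : ℕ} (h : K ≤ K') {s : Fin (n + 2) → ℂ} (hs : s ∈ remDomain d K) :
    contAux d γ F K s = contAux d γ F K' s := by
  induction K', h using Nat.le_induction with
  | base => rfl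
  | succ K' hK ih =>
    rw [ih]
    have hs' := remDomain_mono d hK hs
    rw [contAux, contAux, remSum_succ hd hγ hF hs', Finset.sum_range_succ,
      ← inv_Gamma_mul_Gamma_add (s := s (Fin.last (n + 1))) (i := K')
        (by rw [Complex.add_re, Complex.natCast_re]; linarith [hs'.1])]
    ring

/-- The continuation of the multiple zeta function to the whole space, in terms of a continuation
`F` of the multiple zeta function of smaller depth. Any `K` with `s ∈ remDomain d K` gives the same
value. -/
noncomputable def cont (d : Fin (n + 2) → ℕ) (γ : Fin (n + 2) → ℂ) (F : (Fin (n + 1) → ℂ) → ℂ)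
    (s : Fin (n + 2) → ℂ) : ℂ :=
  contAux d γ F (exists_mem_remDomain d s 0).choose s

theorem cont_eq (hd : ∀ j, 0 < d j) (hγ : ∀ j, 0 < (γ j).re)
    (hF : ∀ s ∈ convDomain (Fin.init d), HasSum (zetaTerm (Fin.init d) (Fin.init γ) s) (F s))
    {K : ℕ} {s : Fin (n + 2) → ℂ} (hs : s ∈ remDomain d K) :
    cont d γ F s = contAux d γ F K s := by
  have h := (exists_mem_remDomain d s 0).choose_spec.2
  rw [cont]
  rcases le_total K (exists_mem_remDomain d s 0).choose with h1 | h1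
  · exact (contAux_eq_of_le hd hγ hF h1 hs).symm
  · exact contAux_eq_of_le hd hγ hF h1 h

theorem cont_eventuallyEq (hd : ∀ j, 0 < d j) (hγ : ∀ j, 0 < (γ j).re)
    (hF : ∀ s ∈ convDomain (Fin.init d), HasSum (zetaTerm (Fin.init d) (Fin.init γ) s) (F s))
    {K : ℕ} {a : Fin (n + 2) → ℂ} (ha : a ∈ remDomain d K) :
    contAux d γ F K =ᶠ[𝓝 a] cont d γ F := by
  filter_upwards [(isOpen_remDomain d K).mem_nhds ha] with s hs using (cont_eq hd hγ hF hs).symm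

/-- In the domain of absolute convergence the formula of order `K = 0` already applies. -/
theorem hasSum_cont (hd : ∀ j, 0 < d j) (hγ : ∀ j, 0 < (γ j).re)
    (hF : ∀ s ∈ convDomain (Fin.init d), HasSum (zetaTerm (Fin.init d) (Fin.init γ) s) (F s))
    {s : Fin (n + 2) → ℂ} (hs : s ∈ convDomain d) : HasSum (zetaTerm d γ s) (cont d γ F s) := by
  set l := Fin.last (n + 1) with hl
  have hγ' : ∀ j, 0 < (Fin.init γ j : ℂ).re := fun j => hγ _
  have hsl : 1 / (d l : ℝ) < (s l).re := by
    have := hs l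
    rwa [sum_Ici_last, sum_Ici_last] at this
  have hdl : (0 : ℝ) < d l := by exact_mod_cast hd l
  have hdl' : 0 < 1 / (d l : ℝ) := by positivity
  have hsum : ∀ j : Fin (n + 1), ∑ i ∈ Finset.Ici j, 1 / (Fin.init d i : ℝ) + 1 / (d l : ℝ)
      < ∑ i ∈ Finset.Ici j.castSucc, (s i).re := by
    intro j
    have := hs j.castSucc
    rwa [sum_Ici_castSucc, Complex.re_sum] at this
  have h0 : s ∈ remDomain d 0 := by
    refine ⟨by simp only [Nat.cast_zero, neg_zero]; linarith, fun j => ?_⟩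
    rw [re_sum_merge, Complex.natCast_re]
    have := hsum j
    push_cast
    linarith
  have hinv : merge s (-(1 / (d l : ℂ))) ∈ convDomain (Fin.init d) := by
    intro j
    have e : (-(1 / (d l : ℂ))).re = -(1 / (d l : ℝ)) := by
      rw [show (-(1 / (d l : ℂ))) = ((-(1 / (d l : ℝ)) : ℝ) : ℂ) by push_cast; rfl,
        Complex.ofReal_re]
    rw [re_sum_merge, e]
    linarith [hsum j]
  have hS := (summable_zetaTerm hd hγ hs).hasSum
  have hS' := ((Equiv.prodComm _ _).trans (Fin.snocEquiv fun _ => ℕ+)).hasSum_iff.2 hS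
  have hfib := hS'.prod_fiberwise (g := fun m => zetaTerm (Fin.init d) (Fin.init γ) (Fin.init s) m
      * (thetaLead (d l) (γ l) * ((Complex.Gamma (s l))⁻¹ * Complex.Gamma (s l - 1 / d l))
          * partialForm (Fin.init d) (Fin.init γ) m (Fin.last n) ^ (-(s l - 1 / d l))
        + ∑ i ∈ Finset.range 0, thetaCoeff (d l) (γ l) i * (ascPochhammer ℂ i).eval (s l)
          * partialForm (Fin.init d) (Fin.init γ) m (Fin.last n) ^ (-(s l + i))
        + (Complex.Gamma (s l))⁻¹ * remMellin (d l) (γ l) 0 (s l)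
          (partialForm (Fin.init d) (Fin.init γ) m (Fin.last n)))) (fun m => by
      have h := (hasSum_inner (hd l) (hγ l) hsl
        (re_partialForm_pos (Fin.init d) hγ' m (Fin.last n)) 0).mul_left
        (zetaTerm (Fin.init d) (Fin.init γ) (Fin.init s) m)
      refine h.congr_fun fun x => ?_
      exact zetaTerm_snoc d γ s m x)
  have htot := ((hF _ hinv).mul_left (thetaLead (d l) (γ l)
    * ((Complex.Gamma (s l))⁻¹ * Complex.Gamma (s l - 1 / d l)))).add
    ((hasSum_remSum hd hγ h0).mul_left (Complex.Gamma (s l))⁻¹)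
  have hcont : cont d γ F s = thetaLead (d l) (γ l)
      * ((Complex.Gamma (s l))⁻¹ * Complex.Gamma (s l - 1 / d l)) * F (merge s (-(1 / d l)))
      + (Complex.Gamma (s l))⁻¹ * remSum d γ 0 s := by
    rw [cont_eq hd hγ hF h0, contAux, Finset.sum_range_zero, add_zero]
  rw [hcont]
  refine hasSum_of_eq hS (hfib.unique (htot.congr_fun fun m => ?_))
  rw [zetaTerm_merge hγ', remTerm, Finset.sum_range_zero, sub_eq_add_neg (s l)]
  ring

theorem isMeromorphic_cont (hd : ∀ j, 0 < d j) (hγ : ∀ j, 0 < (γ j).re)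
    (hF : IsContinuation (Fin.init d) (Fin.init γ) F) : IsMeromorphic (cont d γ F) := by
  intro a
  obtain ⟨K, -, ha⟩ := exists_mem_remDomain d a 0
  have hm : ∀ c, MeroAt (fun s => F (merge s c)) a := fun c => MeroAt.comp_merge (hF.1 _)
  have hΓ : AnalyticAt ℂ (fun s : Fin (n + 2) → ℂ => (Complex.Gamma (s (Fin.last (n + 1))))⁻¹) a :=
    (analyticAt_inv_Gamma _).comp_coord
  refine MeroAt.congr ?_ (cont_eventuallyEq hd hγ hF.2 ha)
  refine MeroAt.add (MeroAt.add ?_ (MeroAt.sum _ fun i _ => ?_)) ?_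
  · exact (analyticAt_const.meroAt.mul (hΓ.meroAt.mul (meroAt_Gamma_coord a _ _))).mul (hm _)
  · refine MeroAt.mul (AnalyticAt.meroAt (analyticAt_const.mul ?_)) (hm _)
    exact ((ascPochhammer ℂ i).differentiable.analyticAt _).comp_coord
  · exact (hΓ.mul (analyticAt_remSum hd hγ ha)).meroAt

theorem analyticAt_cont (hd : ∀ j, 0 < d j) (hγ : ∀ j, 0 < (γ j).re)
    (hF : IsContinuation (Fin.init d) (Fin.init γ) F)
    (hF' : ∀ s, OffPoles (Fin.init d) s → AnalyticAt ℂ F s) {a : Fin (n + 2) → ℂ}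
    (h : OffPoles d a) : AnalyticAt ℂ (cont d γ F) a := by
  obtain ⟨K, -, ha⟩ := exists_mem_remDomain d a 0
  have hm : ∀ c, OffPoles (Fin.init d) (merge a c) → AnalyticAt ℂ (fun s => F (merge s c)) a :=
    fun c hc => (hF' _ hc).comp (f := fun s : Fin (n + 2) → ℂ => merge s c) (analyticAt_merge c a)
  have hΓ : AnalyticAt ℂ (fun s : Fin (n + 2) → ℂ => (Complex.Gamma (s (Fin.last (n + 1))))⁻¹) a :=
    (analyticAt_inv_Gamma _).comp_coord
  have hΓ' : AnalyticAt ℂ (fun s : Fin (n + 2) → ℂ =>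
      Complex.Gamma (s (Fin.last (n + 1)) - 1 / d (Fin.last (n + 1)))) a :=
    (analyticAt_Gamma h.last).comp
      (f := fun s : Fin (n + 2) → ℂ => s (Fin.last (n + 1)) - 1 / (d (Fin.last (n + 1)) : ℂ))
      ((analyticAt_coord a _).sub analyticAt_const)
  refine AnalyticAt.congr ?_ (cont_eventuallyEq hd hγ hF.2 ha)
  refine AnalyticAt.add (AnalyticAt.add ?_ (Finset.analyticAt_fun_sum _ fun i _ => ?_)) ?_
  · exact (analyticAt_const.mul (hΓ.mul hΓ')).mul (hm _ h.merge_inv)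
  · refine AnalyticAt.mul (analyticAt_const.mul ?_) (hm _ (h.merge_nat i))
    exact ((ascPochhammer ℂ i).differentiable.analyticAt _).comp_coord
  · exact hΓ.mul (analyticAt_remSum hd hγ ha)

end Continuation

/-- The multiple zeta function continues to a meromorphic function on the whole space that is
holomorphic off the possible polar hyperplanes. -/
theorem exists_continuation {n : ℕ} (d : Fin (n + 1) → ℕ) (hd : ∀ j, 0 < d j) (γ : Fin (n + 1) → ℂ)
    (hγ : ∀ j, 0 < (γ j).re) :
    ∃ F, IsContinuation d γ F ∧ ∀ s, OffPoles d s → AnalyticAt ℂ F s := by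
  induction n with
  | zero => exact exists_continuation_one d hd γ hγ
  | succ n ih =>
    obtain ⟨F, hF, hF'⟩ := ih (Fin.init d) (fun j => hd _) (Fin.init γ) (fun j => hγ _)
    exact ⟨cont d γ F, ⟨isMeromorphic_cont hd hγ hF, fun s hs => hasSum_cont hd hγ hF.2 hs⟩,
      fun s hs => analyticAt_cont hd hγ hF hF' hs⟩

theorem IsContinuation.isZetaValue {n : ℕ} {d : Fin n → ℕ} {γ : Fin n → ℂ} {F : (Fin n → ℂ) → ℂ}
    (hF : IsContinuation d γ F) {s : Fin n → ℂ} (hs : AnalyticAt ℂ F s) :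
    IsZetaValue d γ s (F s) :=
  ⟨F, hF, F, 1, hs, analyticAt_const, fun H => one_ne_zero H.self_of_nhds,
    Eventually.of_forall fun _ _ => rfl, rfl⟩

end

/-! ### Values at integer points -/

section

theorem NonIntegral.init {n : ℕ} {d : Fin (n + 1) → ℕ} (h : NonIntegral d) :
    NonIntegral (Fin.init d : Fin n → ℕ) := by
  intro j ε hε M hM H
  refine h j.castSucc (Fin.snoc ε 0 : Fin (n + 1) → ℕ) (fun k => ?_) M hM ?_
  · refine Fin.lastCases ?_ (fun k => ?_) k
    · simp
    · simpa using hε k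
  · rw [sum_Ioi_castSucc]
    simpa [Fin.init] using H

theorem NonIntegral.offPoles {n : ℕ} {d : Fin n → ℕ} (hd : ∀ j, 0 < d j) (h : NonIntegral d)
    (N : Fin n → ℤ) : OffPoles d (intPoint N) := by
  intro j ε hε l H
  have h1 : ((∑ i ∈ Finset.Ici j, N i + l : ℤ) : ℚ)
      = 1 / (d j : ℚ) + ∑ k ∈ Finset.Ioi j, (ε k : ℚ) / (d k : ℚ) := by
    have : (((∑ i ∈ Finset.Ici j, N i + l : ℤ) : ℚ) : ℂ)
        = ((1 / (d j : ℚ) + ∑ k ∈ Finset.Ioi j, (ε k : ℚ) / (d k : ℚ) : ℚ) : ℂ) := by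
      push_cast
      simpa [intPoint] using H
    exact_mod_cast this
  have h2 : (0 : ℚ) < 1 / (d j : ℚ) + ∑ k ∈ Finset.Ioi j, (ε k : ℚ) / (d k : ℚ) := by
    have h3 : (0 : ℚ) < d j := by exact_mod_cast hd j
    have h4 : (0 : ℚ) ≤ ∑ k ∈ Finset.Ioi j, (ε k : ℚ) / (d k : ℚ) :=
      Finset.sum_nonneg fun k _ => by positivity
    positivity
  rw [← h1] at h2
  have h5 : 0 < ∑ i ∈ Finset.Ici j, N i + l := by exact_mod_cast h2
  obtain ⟨M, hM⟩ := Int.eq_ofNat_of_zero_le h5.le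
  refine h j ε hε M (by omega) ?_
  rw [← h1, hM]
  simp

theorem intPoint_mergeLast {n : ℕ} (N : Fin (n + 2) → ℤ) (c : ℤ) :
    intPoint (mergeLast N c) = merge (intPoint N) (c : ℂ) := by
  ext j
  refine Fin.lastCases ?_ (fun j => ?_) j
  · simp [intPoint, mergeLast, merge, add_assoc]
  · simp [intPoint, mergeLast, merge, (Fin.castSucc_lt_last j).ne]

theorem ascPochhammer_eval_neg_natCast (M i : ℕ) :
    (ascPochhammer ℂ i).eval (-(M : ℂ)) = (-1) ^ i * (i.factorial * M.choose i : ℂ) := by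
  rw [ascPochhammer_eval_neg_eq_descPochhammer, descPochhammer_eval_eq_descFactorial,
    Nat.descFactorial_eq_factorial_mul_choose]
  push_cast
  rfl

/-- The coefficient of the continuation formula at `s = -M`. -/
theorem thetaCoeff_mul_ascPochhammer (d : ℕ) (γ : ℂ) (M i : ℕ) :
    thetaCoeff d γ i * (ascPochhammer ℂ i).eval (-(M : ℂ))
      = -((bernoulli' (d * i + 1) : ℂ) / (d * i + 1 : ℕ) * M.choose i * γ ^ i) := by
  have h : (i.factorial : ℂ) ≠ 0 := by exact_mod_cast i.factorial_ne_zero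
  have h1 : ((-1 : ℂ) ^ i) * (-1) ^ i = 1 := by rw [← mul_pow]; simp
  rw [ascPochhammer_eval_neg_natCast, thetaCoeff, neg_pow γ]
  calc _ = -((bernoulli' (d * i + 1) : ℂ) / (d * i + 1 : ℕ) * M.choose i * γ ^ i)
        * ((-1 : ℂ) ^ i * (-1) ^ i) * (i.factorial / i.factorial) := by ring
    _ = _ := by rw [h1, div_self h, mul_one, mul_one]

theorem mem_recIndices {e M k : ℕ} :
    k ∈ recIndices e (-(M : ℤ)) ↔ (1 ≤ k ∧ 2 * k - 1 ≤ e * M) ∧ e ∣ 2 * k - 1 := by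
  rw [recIndices, Finset.mem_filter, Finset.mem_Icc]
  have : 1 - (e : ℤ) * -(M : ℤ) = ((1 + e * M : ℕ) : ℤ) := by push_cast; ring
  rw [this]
  refine and_congr_left fun _ => and_congr_right fun _ => ?_
  generalize e * M = x
  omega

/-- Reindexing by `2k - 1 = e i`; the Bernoulli numbers of odd index greater than one vanish. -/
theorem sum_range_eq_sum_recIndices {e : ℕ} (he : 0 < e) (M : ℕ) (g : ℕ → ℂ) :
    ∑ i ∈ Finset.range (M + 1), (bernoulli' (e * i + 1) : ℂ) / (e * i + 1 : ℕ) * g i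
      = 1 / 2 * g 0 + ∑ k ∈ recIndices e (-(M : ℤ)),
        (bernoulli (2 * k) : ℂ) / (2 * k : ℂ) * g ((2 * k - 1) / e) := by
  rw [Finset.sum_range_succ', add_comm]
  congr 1
  · simp
  · symm
    have hk : ∀ k ∈ recIndices e (-(M : ℤ)), ∃ i, i < M ∧ 2 * k - 1 = e * (i + 1) ∧ 1 ≤ k := by
      intro k hk
      obtain ⟨⟨h1, h2⟩, i, hi⟩ := mem_recIndices.1 hk
      rcases i with _ | i
      · omega
      refine ⟨i, ?_, hi, h1⟩
      rw [hi] at h2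
      have := Nat.le_of_mul_le_mul_left h2 he
      omega
    refine Finset.sum_of_injOn (fun k => (2 * k - 1) / e - 1) ?_ ?_ ?_ ?_
    · intro k h k' h' hkk
      obtain ⟨i, -, hi, h1⟩ := hk k h
      obtain ⟨i', -, hi', h1'⟩ := hk k' h'
      simp only [hi, hi', Nat.mul_div_cancel_left _ he, Nat.add_sub_cancel] at hkk
      subst hkk
      omega
    · intro k h
      obtain ⟨i, hiM, hi, -⟩ := hk k h
      simp only [hi, Nat.mul_div_cancel_left _ he, Nat.add_sub_cancel]
      simpa using hiM
    · intro i hi hi'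
      have hodd : Odd (e * (i + 1) + 1) := by
        by_contra hne
        rw [Nat.not_odd_iff_even] at hne
        obtain ⟨k, hk2⟩ := hne
        have h3 : 2 * k - 1 = e * (i + 1) := by omega
        refine hi' ⟨k, mem_recIndices.2 ⟨⟨by omega, ?_⟩, ?_⟩, ?_⟩
        · rw [h3]
          exact Nat.mul_le_mul_left e (Finset.mem_range.1 hi)
        · exact ⟨_, h3⟩
        · simp only [h3, Nat.mul_div_cancel_left _ he, Nat.add_sub_cancel]
      have h4 : 0 < e * (i + 1) := by positivity
      rw [bernoulli'_eq_zero_of_odd hodd (by omega)]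
      simp
    · intro k h
      obtain ⟨i, hiM, hi, h1⟩ := hk k h
      have h5 : e * (i + 1) + 1 = 2 * k := by omega
      simp only [hi, Nat.mul_div_cancel_left _ he, Nat.add_sub_cancel]
      rw [h5, bernoulli_eq_bernoulli'_of_ne_one (by omega)]
      push_cast
      rfl

/-- Where the last variable is `-M`, the factor `1 / Γ` kills the leading term and the remainder. -/
theorem cont_intPoint {n : ℕ} {d : Fin (n + 2) → ℕ} {γ : Fin (n + 2) → ℂ}
    {F : (Fin (n + 1) → ℂ) → ℂ} (hd : ∀ j, 0 < d j) (hγ : ∀ j, 0 < (γ j).re)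
    (hF : ∀ s ∈ convDomain (Fin.init d), HasSum (zetaTerm (Fin.init d) (Fin.init γ) s) (F s))
    (s : Fin (n + 2) → ℂ) (M : ℕ) (hs : s (Fin.last (n + 1)) = -(M : ℂ)) :
    cont d γ F s = -∑ i ∈ Finset.range (M + 1),
      (bernoulli' (d (Fin.last (n + 1)) * i + 1) : ℂ) / (d (Fin.last (n + 1)) * i + 1 : ℕ)
        * (M.choose i * γ (Fin.last (n + 1)) ^ i * F (merge s i)) := by
  obtain ⟨K, hK, hsK⟩ := exists_mem_remDomain d s (M + 1)
  rw [cont_eq hd hγ hF hsK, contAux, hs, Complex.Gamma_neg_nat_eq_zero, inv_zero]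
  simp only [zero_mul, mul_zero, zero_add, add_zero]
  rw [← Finset.sum_neg_distrib]
  symm
  refine Finset.sum_subset_zero_on_sdiff (Finset.range_mono hK) (fun i hi => ?_) fun i _ => ?_
  · rw [thetaCoeff_mul_ascPochhammer, Nat.choose_eq_zero_of_lt]
    · simp
    · simp only [Finset.mem_sdiff, Finset.mem_range] at hi
      omega
  · rw [thetaCoeff_mul_ascPochhammer]
    ring

end

end PowerZeta

theorem theorem1 (n : ℕ) (d : Fin (n + 2) → ℕ) (hd : ∀ j, 0 < d j)
    (γ : Fin (n + 2) → ℂ) (hγ : ∀ j, 0 < (γ j).re)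
    (hnonint : PowerZeta.NonIntegral d)
    (N : Fin (n + 2) → ℤ) (hN : N (Fin.last (n + 1)) ≤ 0) :
    -- all points that occur are regular points of the continued zeta functions
    PowerZeta.IsRegularPoint d γ (PowerZeta.intPoint N) ∧
    PowerZeta.IsRegularPoint (Fin.init d) (Fin.init γ)
      (PowerZeta.intPoint (PowerZeta.mergeLast N 0)) ∧
    (∀ k ∈ PowerZeta.recIndices (d (Fin.last (n + 1))) (N (Fin.last (n + 1))),
      PowerZeta.IsRegularPoint (Fin.init d) (Fin.init γ)
        (PowerZeta.intPoint (PowerZeta.mergeLast N ((2 * k - 1) / d (Fin.last (n + 1)) : ℕ)))) ∧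
    -- the recursion
    PowerZeta.zeta d γ (PowerZeta.intPoint N) =
      -(1 / 2) * PowerZeta.zeta (Fin.init d) (Fin.init γ)
          (PowerZeta.intPoint (PowerZeta.mergeLast N 0))
      - ∑ k ∈ PowerZeta.recIndices (d (Fin.last (n + 1))) (N (Fin.last (n + 1))),
          (bernoulli (2 * k) : ℂ) / (2 * k : ℂ)
          * ((-N (Fin.last (n + 1))).toNat.choose ((2 * k - 1) / d (Fin.last (n + 1))) : ℂ)
          * γ (Fin.last (n + 1)) ^ ((2 * k - 1) / d (Fin.last (n + 1)))
          * PowerZeta.zeta (Fin.init d) (Fin.init γ)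
              (PowerZeta.intPoint (PowerZeta.mergeLast N ((2 * k - 1) / d (Fin.last (n + 1)) : ℕ))) := by
  open PowerZeta in
  have hd' : ∀ j, 0 < (Fin.init d : Fin (n + 1) → ℕ) j := fun j => hd _
  have hγ' : ∀ j, 0 < ((Fin.init γ : Fin (n + 1) → ℂ) j).re := fun j => hγ _
  obtain ⟨F, hF, hFan⟩ := exists_continuation (Fin.init d) hd' (Fin.init γ) hγ'
  have hv : ∀ N' : Fin (n + 1) → ℤ, IsZetaValue (Fin.init d) (Fin.init γ) (intPoint N')
      (F (intPoint N')) := fun N' =>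
    hF.isZetaValue (hFan _ (hnonint.init.offPoles hd' N'))
  have hG : IsContinuation d γ (cont d γ F) :=
    ⟨isMeromorphic_cont hd hγ hF, fun s hs => hasSum_cont hd hγ hF.2 hs⟩
  have hw : IsZetaValue d γ (intPoint N) (cont d γ F (intPoint N)) :=
    hG.isZetaValue (analyticAt_cont hd hγ hF hFan (hnonint.offPoles hd N))
  refine ⟨⟨_, hw⟩, ⟨_, hv _⟩, fun k _ => ⟨_, hv _⟩, ?_⟩
  obtain ⟨M, hM⟩ : ∃ M : ℕ, N (Fin.last (n + 1)) = -(M : ℤ) :=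
    ⟨(-N (Fin.last (n + 1))).toNat, by omega⟩
  rw [hw.zeta_eq, (hv _).zeta_eq, cont_intPoint hd hγ hF.2 (intPoint N) M (by simp [intPoint, hM]),
    sum_range_eq_sum_recIndices (hd _) M fun i =>
      (M.choose i * γ (Fin.last (n + 1)) ^ i * F (merge (intPoint N) i)), hM,
    neg_neg, Int.toNat_natCast, neg_add, ← sub_eq_add_neg, intPoint_mergeLast]
  congr 1
  · simp
  · refine Finset.sum_congr rfl fun k _ => ?_
    rw [(hv _).zeta_eq, intPoint_mergeLast, Int.cast_natCast]
    ring
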